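/- Let $K\ge 1$ and $C>0$. There exists a constant $L=L(K,C)>0$, depending only on $K$ and $C$, with the following property. Let $(X,d)$ be a complete, simply connected $\mathrm{CAT}(-1)$ metric space (that is, a geodesic metric space all of whose geodesic triangles are no fatter than their comparison triangles in the hyperbolic plane of curvature $-1$) such that * $X$ has the geodesic extension property: every local geodesic $c\colon[a,b]\to X$ with $a<b$ extends, for some $\varepsilon>0$, to a local geodesic $[a,b+\varepsilon]\to X$; and * for every $p\in X$ the space of directions at $p$ is connected (here the empty space counts as connected). The space of directions at $p$ is the set of nontrivial geodesic segments issuing from $p$, two of them being identified when their Alexandrov angle at $p$ is $0$, with the Alexandrov angle as metric. Let $F\colon X\to X$ be a $(K,C)$-quasi-isometry, i.e. $$\tfrac1K d(x_1,x_2)-C\le d(Fx_1,Fx_2)\le K d(x_1,x_2)+C\qquad\text{for all }x_1,x_2\in X,$$ and for each $y\in X$ there is $x\in X$ with $d(Fx,y)\le C$. Let $I\colon X\to X$ be a (surjective) isometry. Let $\partial X$ be the set of geodesic rays in $X$ modulo the relation of being at bounded Hausdorff distance, and let $F^\partial, I^\partial\colon\partial X\to\partial X$ be the induced boundary maps, which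 send the class of a ray $\gamma$ to the class of the rays at bounded Hausdorff distance from the image of $F\circ\gamma$, respectively $I\circ\gamma$. If $F^\partial=I^\partial$, then $$d(Fx,Ix)\le L\qquad\text{for every }x\in X.$$ -/

import Mathlib

open Set Filter Topology
open scoped NNReal ENNReal

section Geodesics

variable {X : Type*} [MetricSpace X]

/-- The restriction of `c` to the set `s` of parameters is a geodesic (parametrized by arc
length), i.e. an isometric embedding of `s` into `X`. -/
def IsGeodesicOn (c : ℝ → X) (s : Set ℝ) : Prop :=
  ∀ t ∈ s, ∀ t' ∈ s, dist (c t) (c t') = |t - t'|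

/-- The restriction of `c` to `s` is a local geodesic: a geodesic near each parameter in `s`. -/
def IsLocalGeodesicOn (c : ℝ → X) (s : Set ℝ) : Prop :=
  ∀ t ∈ s, ∃ ε > 0, IsGeodesicOn c (s ∩ Metric.ball t ε)

/-- `c`, restricted to `[0, dist p q]`, is a geodesic segment from `p` to `q`. -/
structure IsGeodesicFromTo (c : ℝ → X) (p q : X) : Prop where
  map_zero : c 0 = p
  map_dist : c (dist p q) = q
  isGeodesicOn : IsGeodesicOn c (Icc 0 (dist p q))

variable (X) in
/-- `X` is a CAT(-1) space: any two points are joined by a geodesic segment, and geodesic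
triangles are not fatter than their comparison triangles in the hyperbolic plane (the upper half
plane with its metric of constant curvature `-1`).

Any two sides of a triangle share a vertex, which is called `p` below; the sides are the images
of `c₁` (from `p` to `q`) and `c₂` (from `p` to `r`), a third side exists by the first clause.
The comparison triangle has vertices `p'`, `q'`, `r'`, and the comparison point of `c₁ s` is
`c₁' s`. (Two points on one and the same side have the distance of their comparison points.)
Comparison triangles exist always and are unique up to isometry, so that it does not matter
which one is taken. -/
structure IsCATNegOne : Prop where
  exists_geodesic : ∀ p q : X, ∃ c : ℝ → X, IsGeodesicFromTo c p q
  comparison : ∀ (p q r : X) (c₁ c₂ : ℝ → X),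
    IsGeodesicFromTo c₁ p q → IsGeodesicFromTo c₂ p r →
    ∃ (p' q' r' : UpperHalfPlane) (c₁' c₂' : ℝ → UpperHalfPlane),
      dist p' q' = dist p q ∧ dist p' r' = dist p r ∧ dist q' r' = dist q r ∧
      IsGeodesicFromTo c₁' p' q' ∧ IsGeodesicFromTo c₂' p' r' ∧
      ∀ s ∈ Icc 0 (dist p q), ∀ t ∈ Icc 0 (dist p r),
        dist (c₁ s) (c₂ t) ≤ dist (c₁' s) (c₂' t)

variable (X) in
/-- The geodesic extension property: every local geodesic `c : [a, b] → X` with `a < b` extends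
to a local geodesic on `[a, b + ε]` for some `ε > 0`. -/
def GeodesicExtensionProperty : Prop :=
  ∀ (a b : ℝ) (c : ℝ → X), a < b → IsLocalGeodesicOn c (Icc a b) →
    ∃ ε > 0, ∃ c' : ℝ → X, IsLocalGeodesicOn c' (Icc a (b + ε)) ∧ EqOn c c' (Icc a b)

end Geodesics

section Directions

variable {X : Type*} [MetricSpace X]

/-- The angle at the vertex corresponding to `p` of a Euclidean triangle whose side lengths are
the distances between `p`, `x` and `y` (for `x ≠ p` and `y ≠ p`), by the law of cosines. -/
noncomputable def comparisonAngle (p x y : X) : ℝ :=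
  Real.arccos ((dist p x ^ 2 + dist p y ^ 2 - dist x y ^ 2) / (2 * dist p x * dist p y))

/-- A nontrivial geodesic `[0, length] → X` issuing from `p`; the values of `toFun` outside
`[0, length]` play no role. -/
structure GeodesicFrom (p : X) where
  toFun : ℝ → X
  length : ℝ
  length_pos : 0 < length
  map_zero : toFun 0 = p
  isGeodesicOn : IsGeodesicOn toFun (Icc 0 length)

/-- The Alexandrov angle at `p` between two geodesics issuing from `p`: the upper limit of the
comparison angles of `c t` and `c' t'` as `t, t' → 0`, `t, t' > 0`. -/
noncomputable def alexandrovAngle {p : X} (c c' : GeodesicFrom p) : ℝ :=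
  limsup (fun z : ℝ × ℝ => comparisonAngle p (c.toFun z.1) (c'.toFun z.2))
    (𝓝[>] (0 : ℝ) ×ˢ 𝓝[>] (0 : ℝ))

theorem comparisonAngle_comm (p x y : X) : comparisonAngle p x y = comparisonAngle p y x := by
  unfold comparisonAngle
  rw [dist_comm x y, add_comm (dist p x ^ 2), mul_right_comm]

theorem cos_comparisonAngle {p x y : X} (hx : 0 < dist p x) (hy : 0 < dist p y) :
    dist x y ^ 2 = dist p x ^ 2 + dist p y ^ 2
      - 2 * dist p x * dist p y * Real.cos (comparisonAngle p x y) := by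
  have h1 := dist_triangle p x y
  have h2 := dist_triangle p y x
  have h3 := dist_triangle x p y
  rw [dist_comm y x] at h2
  rw [dist_comm x p] at h3
  have hd : 0 ≤ dist x y := dist_nonneg
  have hpos : 0 < 2 * dist p x * dist p y := by positivity
  unfold comparisonAngle
  rw [Real.cos_arccos]
  · field_simp
    ring
  · rw [le_div_iff₀ hpos]
    nlinarith
  · rw [div_le_iff₀ hpos]
    nlinarith

theorem GeodesicFrom.dist_eq {p : X} (c : GeodesicFrom p) {t : ℝ} (h0 : 0 < t)
    (h : t ≤ c.length) : dist p (c.toFun t) = t := by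
  have := c.isGeodesicOn 0 ⟨le_rfl, c.length_pos.le⟩ t ⟨h0.le, h⟩
  rw [c.map_zero] at this
  rw [this, zero_sub, abs_neg, abs_of_pos h0]

theorem isBoundedUnder_comparisonAngle {p : X} (c c' : GeodesicFrom p) (l : Filter (ℝ × ℝ)) :
    IsBoundedUnder (· ≤ ·) l
      (fun z : ℝ × ℝ => comparisonAngle p (c.toFun z.1) (c'.toFun z.2)) :=
  isBoundedUnder_of ⟨Real.pi, fun _ => Real.arccos_le_pi _⟩

theorem isBoundedUnder_comparisonAngle' {p : X} (c c' : GeodesicFrom p) (l : Filter (ℝ × ℝ)) :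
    IsBoundedUnder (· ≥ ·) l
      (fun z : ℝ × ℝ => comparisonAngle p (c.toFun z.1) (c'.toFun z.2)) :=
  isBoundedUnder_of ⟨0, fun _ => Real.arccos_nonneg _⟩

theorem alexandrovAngle_nonneg {p : X} (c c' : GeodesicFrom p) : 0 ≤ alexandrovAngle c c' :=
  le_limsup_of_frequently_le (Frequently.of_forall fun _ => Real.arccos_nonneg _)
    (isBoundedUnder_comparisonAngle c c' _)

theorem alexandrovAngle_le_pi {p : X} (c c' : GeodesicFrom p) :
    alexandrovAngle c c' ≤ Real.pi :=
  limsup_le_of_le (isBoundedUnder_comparisonAngle' c c' _).isCoboundedUnder_le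
    (Eventually.of_forall fun _ => Real.arccos_le_pi _)

theorem alexandrovAngle_comm {p : X} (c c' : GeodesicFrom p) :
    alexandrovAngle c c' = alexandrovAngle c' c := by
  have h : (fun z : ℝ × ℝ => comparisonAngle p (c.toFun z.1) (c'.toFun z.2))
      = (fun z : ℝ × ℝ => comparisonAngle p (c'.toFun z.1) (c.toFun z.2)) ∘ Prod.swap :=
    funext fun z => comparisonAngle_comm p _ _
  unfold alexandrovAngle
  rw [h, limsup_comp, ← Filter.prod_comm]

theorem eventually_mem_Ioo_nhdsGT {r : ℝ} (hr : 0 < r) : ∀ᶠ t in 𝓝[>] (0 : ℝ), t ∈ Ioo 0 r :=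
  Ioo_mem_nhdsGT hr

theorem alexandrovAngle_self {p : X} (c : GeodesicFrom p) : alexandrovAngle c c = 0 := by
  have h : ∀ᶠ z in 𝓝[>] (0 : ℝ) ×ˢ 𝓝[>] (0 : ℝ),
      comparisonAngle p (c.toFun z.1) (c.toFun z.2) = 0 := by
    have h1 := eventually_mem_Ioo_nhdsGT c.length_pos
    filter_upwards [h1.prod_mk h1] with z hz
    obtain ⟨⟨h1, h2⟩, ⟨h3, h4⟩⟩ := hz
    have hd := c.isGeodesicOn z.1 ⟨h1.le, h2.le⟩ z.2 ⟨h3.le, h4.le⟩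
    unfold comparisonAngle
    rw [c.dist_eq h1 h2.le, c.dist_eq h3 h4.le, hd, sq_abs, Real.arccos_eq_zero,
      le_div_iff₀ (by positivity)]
    nlinarith
  unfold alexandrovAngle
  rw [limsup_congr h, limsup_const]

/-- The planar triangle with sides `s`, `u` and angle `a + b` between them, cut into two triangles
with angles `a` and `b` by a segment of length `t`; `D` is the third side. -/
theorem exists_planar_cut {s u a b ε : ℝ} (hs0 : 0 < s) (hu0 : 0 < u) (ha : 0 < a) (hb : 0 < b)
    (habpi : a + b < Real.pi) (hsε : s < ε) (huε : u < ε) :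
    ∃ t m D : ℝ, 0 < t ∧ t < ε ∧ 0 < m ∧ m < 1 ∧ 0 ≤ D ∧
      D ^ 2 = s ^ 2 + u ^ 2 - 2 * s * u * Real.cos (a + b) ∧
      s ^ 2 + t ^ 2 - 2 * s * t * Real.cos a = ((1 - m) * D) ^ 2 ∧
      t ^ 2 + u ^ 2 - 2 * t * u * Real.cos b = (m * D) ^ 2 := by
  have hsa : 0 < Real.sin a := Real.sin_pos_of_pos_of_lt_pi ha (by linarith)
  have hsb : 0 < Real.sin b := Real.sin_pos_of_pos_of_lt_pi hb (by linarith)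
  have hsab : 0 < Real.sin (a + b) := Real.sin_pos_of_pos_of_lt_pi (by linarith) habpi
  have hM : 0 < s * Real.sin a + u * Real.sin b := by positivity
  obtain ⟨m, hm⟩ : ∃ m, m = u * Real.sin b / (s * Real.sin a + u * Real.sin b) := ⟨_, rfl⟩
  have hm0 : 0 < m := by rw [hm]; positivity
  have hmM : m * (s * Real.sin a + u * Real.sin b) = u * Real.sin b := by
    rw [hm]; field_simp
  have hm1 : m < 1 := by
    rw [hm, div_lt_one hM]
    have : 0 < s * Real.sin a := by positivity
    linarith
  obtain ⟨t, ht⟩ : ∃ t, t = m * (s * Real.cos a) + (1 - m) * (u * Real.cos b) := ⟨_, rfl⟩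
  have htM : t * (s * Real.sin a + u * Real.sin b) = s * u * Real.sin (a + b) := by
    rw [Real.sin_add, ht]
    linear_combination (s * Real.cos a - u * Real.cos b) * hmM
  have ht0 : 0 < t := by
    by_contra! hneg
    have : 0 < s * u * Real.sin (a + b) := by positivity
    nlinarith
  have htε : t < ε := by
    have i1 : s * Real.cos a ≤ s := by nlinarith [Real.cos_le_one a]
    have i2 : u * Real.cos b ≤ u := by nlinarith [Real.cos_le_one b]
    rw [ht]
    nlinarith
  have hsu' : 0 < 2 * s * u := by positivity
  obtain ⟨D, hD0, hD⟩ : ∃ D, 0 ≤ D ∧ D ^ 2 = s ^ 2 + u ^ 2 - 2 * s * u * Real.cos (a + b) := by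
    refine ⟨Real.sqrt _, Real.sqrt_nonneg _, Real.sq_sqrt ?_⟩
    nlinarith [Real.cos_le_one (a + b), sq_nonneg (s - u)]
  have sa := Real.sin_sq_add_cos_sq a
  have sb := Real.sin_sq_add_cos_sq b
  have hD' : D ^ 2 = (s * Real.cos a - u * Real.cos b) ^ 2
      + (s * Real.sin a + u * Real.sin b) ^ 2 := by
    rw [hD, Real.cos_add]
    linear_combination (-s ^ 2) * sa - u ^ 2 * sb
  have f1 : s ^ 2 + t ^ 2 - 2 * s * t * Real.cos a = ((1 - m) * D) ^ 2 := by
    have g1 : t - s * Real.cos a = (1 - m) * (u * Real.cos b - s * Real.cos a) := by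
      rw [ht]; ring
    have g2 : s * Real.sin a = (1 - m) * (s * Real.sin a + u * Real.sin b) := by
      linear_combination hmM
    have : s ^ 2 + t ^ 2 - 2 * s * t * Real.cos a
        = (t - s * Real.cos a) ^ 2 + (s * Real.sin a) ^ 2 := by
      linear_combination (-s ^ 2) * sa
    rw [this, g1, g2, mul_pow _ D, hD']
    ring
  have f2 : t ^ 2 + u ^ 2 - 2 * t * u * Real.cos b = (m * D) ^ 2 := by
    have g1 : t - u * Real.cos b = m * (s * Real.cos a - u * Real.cos b) := by
      rw [ht]; ring
    have : t ^ 2 + u ^ 2 - 2 * t * u * Real.cos b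
        = (t - u * Real.cos b) ^ 2 + (u * Real.sin b) ^ 2 := by
      linear_combination (-u ^ 2) * sb
    rw [this, g1, ← hmM, mul_pow m D, hD']
    ring
  exact ⟨t, m, D, ht0, htε, hm0, hm1, hD0, hD, f1, f2⟩

/-- The Alexandrov angle satisfies the triangle inequality. -/
theorem alexandrovAngle_triangle {p : X} (c c' c'' : GeodesicFrom p) :
    alexandrovAngle c c'' ≤ alexandrovAngle c c' + alexandrovAngle c' c'' := by
  by_contra! hlt
  have hA := alexandrovAngle_nonneg c c'
  have hB := alexandrovAngle_nonneg c' c''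
  have hG := alexandrovAngle_le_pi c c''
  obtain ⟨a, haA, b, hbB, hab⟩ : ∃ a, alexandrovAngle c c' < a ∧ ∃ b,
      alexandrovAngle c' c'' < b ∧ a + b < alexandrovAngle c c'' := by
    set δ := (alexandrovAngle c c'' - (alexandrovAngle c c' + alexandrovAngle c' c'')) / 3
      with hδ
    exact ⟨alexandrovAngle c c' + δ, by linarith, alexandrovAngle c' c'' + δ, by linarith,
      by linarith⟩
  have ha : 0 < a := by linarith
  have hb : 0 < b := by linarith
  have habpi : a + b < Real.pi := by linarith
  have e1 := eventually_lt_of_limsup_lt haA (isBoundedUnder_comparisonAngle c c' _)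
  have e2 := eventually_lt_of_limsup_lt hbB (isBoundedUnder_comparisonAngle c' c'' _)
  have e3 := frequently_lt_of_lt_limsup
    (isBoundedUnder_comparisonAngle' c c'' _).isCoboundedUnder_le hab
  -- a common range `(0, ε)` of parameters for the two eventual bounds
  have hbasis := (nhdsGT_basis (0 : ℝ)).prod_self
  obtain ⟨ε₁, hε₁, H1⟩ := hbasis.eventually_iff.1 e1
  obtain ⟨ε₂, hε₂, H2⟩ := hbasis.eventually_iff.1 e2
  obtain ⟨ε, hε, l1, l2, l3, l4, l5⟩ : ∃ ε > 0, ε ≤ ε₁ ∧ ε ≤ ε₂ ∧ ε ≤ c.length ∧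
      ε ≤ c'.length ∧ ε ≤ c''.length := by
    refine ⟨min ε₁ (min ε₂ (min c.length (min c'.length c''.length))), ?_, ?_⟩
    · simp only [gt_iff_lt, lt_min_iff]
      exact ⟨hε₁, hε₂, c.length_pos, c'.length_pos, c''.length_pos⟩
    · simp only [min_le_iff, le_refl, true_or, or_true, and_self]
  have hmem := eventually_mem_Ioo_nhdsGT hε
  obtain ⟨⟨s, u⟩, hsu, ⟨hs0, hsε⟩, ⟨hu0, huε⟩⟩ := (e3.and_eventually (hmem.prod_mk hmem)).exists
  dsimp only at hsu hs0 hsε hu0 huε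
  obtain ⟨t, m, D, ht0, htε, hm0, hm1, hD0, hD, f1, f2⟩ :=
    exists_planar_cut hs0 hu0 ha hb habpi hsε huε
  -- the three distances
  have ds := c.dist_eq hs0 (by linarith)
  have dt := c'.dist_eq ht0 (by linarith)
  have du := c''.dist_eq hu0 (by linarith)
  have k1 : comparisonAngle p (c.toFun s) (c'.toFun t) < a :=
    H1 (x := (s, t)) ⟨⟨hs0, by linarith⟩, ⟨ht0, by linarith⟩⟩
  have k2 : comparisonAngle p (c'.toFun t) (c''.toFun u) < b :=
    H2 (x := (t, u)) ⟨⟨ht0, by linarith⟩, ⟨hu0, by linarith⟩⟩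
  have c1 := Real.cos_lt_cos_of_nonneg_of_le_pi (Real.arccos_nonneg _)
    (by linarith : a ≤ Real.pi) k1
  have c2 := Real.cos_lt_cos_of_nonneg_of_le_pi (Real.arccos_nonneg _)
    (by linarith : b ≤ Real.pi) k2
  have c3 := Real.cos_lt_cos_of_nonneg_of_le_pi (by linarith : 0 ≤ a + b)
    (Real.arccos_le_pi _) hsu
  have q1 := cos_comparisonAngle (p := p) (x := c.toFun s) (y := c'.toFun t)
    (by rw [ds]; exact hs0) (by rw [dt]; exact ht0)
  have q2 := cos_comparisonAngle (p := p) (x := c'.toFun t) (y := c''.toFun u)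
    (by rw [dt]; exact ht0) (by rw [du]; exact hu0)
  have q3 := cos_comparisonAngle (p := p) (x := c.toFun s) (y := c''.toFun u)
    (by rw [ds]; exact hs0) (by rw [du]; exact hu0)
  rw [ds, dt] at q1
  rw [dt, du] at q2
  rw [ds, du] at q3
  have hst : 0 < 2 * s * t := by positivity
  have htu : 0 < 2 * t * u := by positivity
  have hsu' : 0 < 2 * s * u := by positivity
  have r1 : dist (c.toFun s) (c'.toFun t) < (1 - m) * D := by
    refine lt_of_pow_lt_pow_left₀ 2 (mul_nonneg (by linarith) hD0) ?_
    rw [q1, ← f1]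
    have := mul_lt_mul_of_pos_left c1 hst
    unfold comparisonAngle at this ⊢
    linarith
  have r2 : dist (c'.toFun t) (c''.toFun u) < m * D := by
    refine lt_of_pow_lt_pow_left₀ 2 (mul_nonneg hm0.le hD0) ?_
    rw [q2, ← f2]
    have := mul_lt_mul_of_pos_left c2 htu
    unfold comparisonAngle at this ⊢
    linarith
  have r3 : D < dist (c.toFun s) (c''.toFun u) := by
    refine lt_of_pow_lt_pow_left₀ 2 dist_nonneg ?_
    rw [q3, hD]
    have := mul_lt_mul_of_pos_left c3 hsu'
    unfold comparisonAngle at this ⊢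
    linarith
  have := dist_triangle (c.toFun s) (c'.toFun t) (c''.toFun u)
  linarith

/-- The geodesics issuing from `p`, with the Alexandrov angle as a pseudometric. -/
noncomputable instance GeodesicFrom.instPseudoMetricSpace (p : X) :
    PseudoMetricSpace (GeodesicFrom p) where
  dist := alexandrovAngle
  dist_self := alexandrovAngle_self
  dist_comm := alexandrovAngle_comm
  dist_triangle := alexandrovAngle_triangle

/-- The space of directions at `p`: the geodesics issuing from `p`, where two of them are
identified when their Alexandrov angle is zero, with the Alexandrov angle as metric. -/
abbrev SpaceOfDirections (p : X) : Type _ := SeparationQuotient (GeodesicFrom p)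

end Directions

section Boundary

variable {X Y : Type*} [MetricSpace X] [MetricSpace Y]

variable (X) in
/-- Geodesic rays in `X`. -/
structure GeodesicRay where
  toFun : ℝ≥0 → X
  isometry : Isometry toFun

variable (X) in
/-- Two geodesic rays are equivalent if (their images) are at bounded Hausdorff distance. -/
def GeodesicRay.setoid : Setoid (GeodesicRay X) where
  r γ γ' := Metric.hausdorffEDist (range γ.toFun) (range γ'.toFun) ≠ ⊤
  iseqv :=
    { refl := fun γ => by simp
      symm := fun {γ γ'} h => by rwa [Metric.hausdorffEDist_comm]
      trans := fun {γ γ' γ''} h h' =>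
        ((Metric.hausdorffEDist_triangle).trans_lt
          (ENNReal.add_lt_top.2 ⟨h.lt_top, h'.lt_top⟩)).ne }

variable (X) in
/-- The boundary at infinity of `X`: equivalence classes of geodesic rays. -/
def Boundary : Type _ := Quotient (GeodesicRay.setoid X)

/-- The boundary point represented by a ray. -/
def GeodesicRay.endpoint (γ : GeodesicRay X) : Boundary X := Quotient.mk (GeodesicRay.setoid X) γ

/-- `f` is the boundary map of `F`: it sends the class of a ray `γ` to the class that consists of
the rays at bounded Hausdorff distance from the image of `γ` under `F`. -/
def HasBoundaryMap (F : X → Y) (f : Boundary X → Boundary Y) : Prop :=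
  ∀ (γ : GeodesicRay X) (γ' : GeodesicRay Y), f γ.endpoint = γ'.endpoint ↔
    Metric.hausdorffEDist (range (F ∘ γ.toFun)) (range γ'.toFun) ≠ ⊤

/-- The boundary map is determined by the map. -/
theorem HasBoundaryMap.unique {F : X → Y} {f g : Boundary X → Boundary Y}
    (hf : HasBoundaryMap F f) (hg : HasBoundaryMap F g) : f = g := by
  funext ξ
  induction ξ using Quotient.inductionOn with
  | h γ =>
    obtain ⟨γ', hγ'⟩ := Quotient.exists_rep (f (GeodesicRay.endpoint γ))
    have h : f γ.endpoint = γ'.endpoint := hγ'.symm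
    exact h.trans ((hg γ γ').2 ((hf γ γ').1 h)).symm

/-- Isometric embeddings have boundary maps. -/
theorem Isometry.exists_hasBoundaryMap {F : X → Y} (hF : Isometry F) :
    ∃ f, HasBoundaryMap F f := by
  refine ⟨Quotient.map' (s₁ := GeodesicRay.setoid X) (s₂ := GeodesicRay.setoid Y)
    (fun γ => ⟨F ∘ γ.toFun, hF.comp γ.isometry⟩) ?_, fun γ γ' => ?_⟩
  · intro γ γ' h
    change Metric.hausdorffEDist (range (F ∘ γ.toFun)) (range (F ∘ γ'.toFun)) ≠ ⊤
    rw [range_comp, range_comp, Metric.hausdorffEDist_image hF]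
    exact h
  · exact Quotient.eq (r := GeodesicRay.setoid Y)

end Boundary

section QuasiIsometries

variable {X Y : Type*} [MetricSpace X] [MetricSpace Y]

/-- `F` is a `(K, C)`-quasi-isometry: it is `(K, C)`-quasi-isometric and `C`-coarsely onto. -/
structure IsQuasiIsometry (K C : ℝ) (F : X → Y) : Prop where
  lower : ∀ x₁ x₂, (1 / K) * dist x₁ x₂ - C ≤ dist (F x₁) (F x₂)
  upper : ∀ x₁ x₂, dist (F x₁) (F x₂) ≤ K * dist x₁ x₂ + C
  coarselyOnto : ∀ y, ∃ x, dist (F x) y ≤ C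

end QuasiIsometries

/-! ### Stewart's theorem in the hyperbolic plane and as an inequality under `CAT(-1)`. -/

section Stewart

/-! After composition with the inverse of `I`, the task is to bound the displacement of a
quasi-isometric embedding `G` that fixes every boundary point. Each point `x` is the coarse centre
of an ideal triangle, and such a centre is coarsely determined by the vertices, which `G` fixes.

The triangle comes from the local hypotheses. By geodesic extension, a direction `v` at `x` has an
opposite `w`; since the space of directions is connected, some `u` makes the angle `π / 2` with `v`,
hence at least `π / 2` with `w`. Extended to rays, the three directions diverge pairwise with the
universal defect `log 4` (`IsCATNegOne.exists_three_rays`).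

Two of these rays form a quasi-geodesic through `x`, and so do their images through `G x`. The Morse
lemma (`exists_gromovProduct_le_of_quasiGeodesic`) bounds the Gromov products at `G x` of far points
on the images. Far out, these may be replaced by points of the original rays. How close `G` keeps a
ray to itself is not uniform, but this affects only how far out one must go, not the bound. So `x`
and `G x` are both coarse centres of one tripod, and `IsGromovHyperbolic.dist_le_of_tripod` bounds
their distance.

Triangle comparison enters only through the Stewart inequality `IsCATNegOne.stewart`, which yields
hyperbolicity, the passage from local to global geodesics, and the divergence of the rays. -/

/-- A null vector orthogonal to a timelike vector vanishes (for the form `αγ - β²`). -/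
theorem null_orthogonal_timelike {a b g am bm gm : ℝ} (hm : am * gm - bm ^ 2 = 1) (ham : 0 < am)
    (hnull : a * g = b ^ 2) (horth : a * gm + g * am = 2 * b * bm) : a = 0 ∧ b = 0 ∧ g = 0 := by
  have hgm : 0 < gm := by
    by_contra! h
    nlinarith [sq_nonneg bm, mul_nonneg ham.le (neg_nonneg.2 h)]
  -- Squaring the orthogonality relation and inserting nullity leaves a vanishing sum of squares.
  have h1 : (a * gm - g * am) ^ 2 + 4 * b ^ 2 = 0 := by
    have : (a * gm + g * am) ^ 2 = 4 * b ^ 2 * bm ^ 2 := by rw [horth]; ring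
    have h2 : am * gm = 1 + bm ^ 2 := by linarith
    have h3 : (a * gm - g * am) ^ 2 = (a * gm + g * am) ^ 2 - 4 * (a * g) * (am * gm) := by ring
    rw [h3, this, hnull, h2]
    ring
  have hb : b = 0 := by
    have : b ^ 2 = 0 := by nlinarith [sq_nonneg (a * gm - g * am), sq_nonneg b]
    exact pow_eq_zero_iff (two_ne_zero) |>.1 this
  subst hb
  have h2 : a * gm - g * am = 0 := by
    apply pow_eq_zero_iff (two_ne_zero) |>.1
    simpa using h1
  have h3 : a * gm = 0 := by linarith
  have h4 : g * am = 0 := by linarith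
  exact ⟨(mul_eq_zero.1 h3).resolve_right hgm.ne', rfl, (mul_eq_zero.1 h4).resolve_right ham.ne'⟩

/-- The hyperboloid model: `z ↦ (1 / im z, re z / im z, |z|² / im z)` lands in `αγ - β² = 1`, and
the hyperbolic cosine of the distance is the polarization of that form. -/
theorem UpperHalfPlane.cosh_dist_eq_form (z w : UpperHalfPlane) :
    Real.cosh (dist z w) = ((1 / z.im) * ((w.re ^ 2 + w.im ^ 2) / w.im)
      + (1 / w.im) * ((z.re ^ 2 + z.im ^ 2) / z.im)
      - 2 * (z.re / z.im) * (w.re / w.im)) / 2 := by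
  have hz := z.im_pos
  have hw := w.im_pos
  rw [UpperHalfPlane.cosh_dist']
  field_simp
  ring

/-- Stewart's theorem in the hyperbolic plane. -/
theorem UpperHalfPlane.stewart {p m q : UpperHalfPlane} (r : UpperHalfPlane)
    (h : dist p m + dist m q = dist p q) :
    Real.cosh (dist r m) * Real.sinh (dist p q) =
      Real.cosh (dist r p) * Real.sinh (dist m q) + Real.cosh (dist r q) * Real.sinh (dist p m) := by
  have form (z : UpperHalfPlane) :
      (1 / z.im) * ((z.re ^ 2 + z.im ^ 2) / z.im) - (z.re / z.im) ^ 2 = 1 := by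
    have hz := z.im_pos
    field_simp
    ring
  have fp := form p
  have fm := form m
  have fq := form q
  have hpm := UpperHalfPlane.cosh_dist_eq_form p m
  have hmq := UpperHalfPlane.cosh_dist_eq_form m q
  have hpq := UpperHalfPlane.cosh_dist_eq_form p q
  have ham : 0 < 1 / m.im := one_div_pos.2 m.im_pos
  rw [UpperHalfPlane.cosh_dist_eq_form r m, UpperHalfPlane.cosh_dist_eq_form r p,
    UpperHalfPlane.cosh_dist_eq_form r q]
  rw [← h] at hpq ⊢
  generalize dist p m = s at *
  generalize dist m q = u at *
  generalize 1 / p.im = ap at *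
  generalize p.re / p.im = bp at *
  generalize (p.re ^ 2 + p.im ^ 2) / p.im = gp at *
  generalize 1 / q.im = aq at *
  generalize q.re / q.im = bq at *
  generalize (q.re ^ 2 + q.im ^ 2) / q.im = gq at *
  generalize 1 / m.im = am at *
  generalize m.re / m.im = bm at *
  generalize (m.re ^ 2 + m.im ^ 2) / m.im = gm at *
  generalize 1 / r.im = ar at *
  generalize r.re / r.im = br at *
  generalize (r.re ^ 2 + r.im ^ 2) / r.im = gr at *
  rw [Real.cosh_add] at hpq
  rw [Real.sinh_add]
  have es := Real.cosh_sq s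
  have eu := Real.cosh_sq u
  generalize Real.cosh s = cs at *
  generalize Real.cosh u = cu at *
  generalize Real.sinh s = ss at *
  generalize Real.sinh u = su at *
  -- The vector `sinh (s + u) m - sinh u p - sinh s q` is null and orthogonal to `m`, so it
  -- vanishes. Pairing it with `r` gives the claim.
  obtain ⟨h1, h2, h3⟩ := null_orthogonal_timelike
    (a := (ss * cu + cs * su) * am - su * ap - ss * aq)
    (b := (ss * cu + cs * su) * bm - su * bp - ss * bq)
    (g := (ss * cu + cs * su) * gm - su * gp - ss * gq) fm ham (by
      linear_combination (ss * cu + cs * su) ^ 2 * fm + su ^ 2 * fp + ss ^ 2 * fq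
        + 2 * (ss * cu + cs * su) * su * hpm + 2 * (ss * cu + cs * su) * ss * hmq
        - 2 * su * ss * hpq - su ^ 2 * es - ss ^ 2 * eu) (by
      linear_combination 2 * (ss * cu + cs * su) * fm + 2 * su * hpm + 2 * ss * hmq)
  linear_combination (gr / 2) * h1 + (ar / 2) * h3 - br * h2

variable {X : Type*} [MetricSpace X]

theorem IsGeodesicOn.mono {c : ℝ → X} {s t : Set ℝ} (h : IsGeodesicOn c t) (hst : s ⊆ t) :
    IsGeodesicOn c s :=
  fun a ha b hb => h a (hst ha) b (hst hb)

theorem IsGeodesicOn.congr {c c' : ℝ → X} {s : Set ℝ} (h : IsGeodesicOn c s) (hc : EqOn c c' s) :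
    IsGeodesicOn c' s := by
  intro a ha b hb
  rw [← hc ha, ← hc hb]
  exact h a ha b hb

/-- The Stewart inequality in a `CAT(-1)` space. -/
theorem IsCATNegOne.stewart (hX : IsCATNegOne X) {c : ℝ → X} {a b t : ℝ}
    (hc : IsGeodesicOn c (Icc a b)) (ht : t ∈ Icc a b) (r : X) :
    Real.cosh (dist r (c t)) * Real.sinh (b - a) ≤
      Real.cosh (dist r (c a)) * Real.sinh (b - t) + Real.cosh (dist r (c b)) * Real.sinh (t - a) := by
  have hab : a ≤ b := ht.1.trans ht.2
  have hd : dist (c a) (c b) = b - a := by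
    rw [hc a (left_mem_Icc.2 hab) b (right_mem_Icc.2 hab), abs_sub_comm,
      abs_of_nonneg (sub_nonneg.2 hab)]
  have h1 : IsGeodesicFromTo (fun τ => c (a + τ)) (c a) (c b) := by
    refine ⟨by simp, by simp [hd], ?_⟩
    rw [hd]
    intro τ hτ τ' hτ'
    rw [hc (a + τ) ⟨by linarith [hτ.1], by linarith [hτ.2]⟩
      (a + τ') ⟨by linarith [hτ'.1], by linarith [hτ'.2]⟩]
    congr 1
    ring
  obtain ⟨c₂, h2⟩ := hX.exists_geodesic (c a) r
  obtain ⟨p', q', r', c₁', c₂', e1, e2, e3, g1, g2, H⟩ := hX.comparison _ _ _ _ _ h1 h2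
  have htm : t - a ∈ Icc 0 (dist p' q') := by
    rw [e1, hd]; exact ⟨by linarith [ht.1], by linarith [ht.2]⟩
  -- Only the far endpoint `r` of the second side is compared with points of the first.
  have H' := H (t - a) (by rw [← e1]; exact htm) (dist (c a) r) (right_mem_Icc.2 dist_nonneg)
  rw [h2.map_dist, ← e2, g2.map_dist] at H'
  simp only [add_sub_cancel] at H'
  have d1 : dist p' (c₁' (t - a)) = t - a := by
    have := g1.isGeodesicOn 0 (left_mem_Icc.2 dist_nonneg) _ htm
    rw [g1.map_zero] at this
    rw [this, zero_sub, abs_neg, abs_of_nonneg htm.1]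
  have d2 : dist (c₁' (t - a)) q' = b - t := by
    have := g1.isGeodesicOn _ htm _ (right_mem_Icc.2 dist_nonneg)
    rw [g1.map_dist] at this
    rw [this, abs_sub_comm, abs_of_nonneg (sub_nonneg.2 htm.2), e1, hd]
    ring
  have S := UpperHalfPlane.stewart r' (p := p') (m := c₁' (t - a)) (q := q') (by
    rw [d1, d2, e1, hd]; ring)
  rw [d1, d2, e1, hd, dist_comm r' p', e2, dist_comm r' q', e3, dist_comm (c a),
    dist_comm (c b)] at S
  rw [← S]
  refine mul_le_mul_of_nonneg_right ?_ (Real.sinh_nonneg_iff.2 (by linarith))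
  rw [Real.cosh_le_cosh, abs_of_nonneg dist_nonneg, abs_of_nonneg dist_nonneg, dist_comm,
    dist_comm r']
  exact H'

end Stewart

/-! ### Gromov hyperbolicity. -/

section Hyperbolic

variable {X : Type*} [MetricSpace X]

/-- The Gromov product of `x` and `y` with respect to `e`. -/
noncomputable def gromovProduct (e x y : X) : ℝ := (dist e x + dist e y - dist x y) / 2

theorem gromovProduct_comm (e x y : X) : gromovProduct e x y = gromovProduct e y x := by
  unfold gromovProduct
  rw [dist_comm x y, add_comm (dist e x)]

theorem gromovProduct_self (e x : X) : gromovProduct e x x = dist e x := by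
  unfold gromovProduct
  rw [dist_self]
  ring

variable (X) in
/-- Gromov's four point condition with constant `δ`. -/
def IsGromovHyperbolic (δ : ℝ) : Prop :=
  ∀ e x y z : X, min (gromovProduct e x y) (gromovProduct e y z) - δ ≤ gromovProduct e x z

/-- A point of a side of a triangle lies, up to `log 4`, on one of the other two sides. -/
theorem IsCATNegOne.dist_side_le (hX : IsCATNegOne X) {c : ℝ → X} {a b t : ℝ}
    (hc : IsGeodesicOn c (Icc a b)) (ht : t ∈ Icc a b) (r : X) :
    dist r (c t) ≤ max (dist r (c a) - (t - a)) (dist r (c b) - (b - t)) + Real.log 4 := by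
  have S := hX.stewart hc ht r
  have hlog : 0 ≤ Real.log 4 := Real.log_nonneg (by norm_num)
  rcases (ht.1.trans ht.2).eq_or_lt with hab | hab
  · have : t = a := by linarith [ht.1, ht.2]
    rw [this]
    linarith [le_max_left (dist r (c a) - (a - a)) (dist r (c b) - (b - a))]
  set M := max (dist r (c a) - (t - a)) (dist r (c b) - (b - t)) with hM
  have hs : 0 ≤ t - a := by linarith [ht.1]
  have hu : 0 ≤ b - t := by linarith [ht.2]
  have hL : 0 < Real.sinh (b - a) := Real.sinh_pos_iff.2 (by linarith)
  have i1 : Real.cosh (dist r (c a)) ≤ Real.exp M * (2 * Real.cosh (t - a)) := by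
    have : Real.cosh (dist r (c a)) ≤ Real.exp (dist r (c a)) := by
      rw [Real.cosh_eq]
      have : Real.exp (-dist r (c a)) ≤ Real.exp (dist r (c a)) :=
        Real.exp_le_exp.2 (by linarith [dist_nonneg (x := r) (y := c a)])
      linarith
    have h2 : Real.exp (dist r (c a)) ≤ Real.exp M * Real.exp (t - a) := by
      rw [← Real.exp_add, Real.exp_le_exp]
      linarith [le_max_left (dist r (c a) - (t - a)) (dist r (c b) - (b - t))]
    have h3 : Real.exp (t - a) ≤ 2 * Real.cosh (t - a) := by
      rw [Real.cosh_eq]; linarith [Real.exp_pos (-(t - a))]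
    nlinarith [Real.exp_pos M]
  have i2 : Real.cosh (dist r (c b)) ≤ Real.exp M * (2 * Real.cosh (b - t)) := by
    have : Real.cosh (dist r (c b)) ≤ Real.exp (dist r (c b)) := by
      rw [Real.cosh_eq]
      have : Real.exp (-dist r (c b)) ≤ Real.exp (dist r (c b)) :=
        Real.exp_le_exp.2 (by linarith [dist_nonneg (x := r) (y := c b)])
      linarith
    have h2 : Real.exp (dist r (c b)) ≤ Real.exp M * Real.exp (b - t) := by
      rw [← Real.exp_add, Real.exp_le_exp]
      linarith [le_max_right (dist r (c a) - (t - a)) (dist r (c b) - (b - t))]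
    have h3 : Real.exp (b - t) ≤ 2 * Real.cosh (b - t) := by
      rw [Real.cosh_eq]; linarith [Real.exp_pos (-(b - t))]
    nlinarith [Real.exp_pos M]
  have i3 : Real.exp (dist r (c t)) / 2 ≤ Real.cosh (dist r (c t)) := by
    rw [Real.cosh_eq]; linarith [Real.exp_pos (-dist r (c t))]
  have e : Real.sinh (b - a) = Real.sinh (b - t) * Real.cosh (t - a)
      + Real.cosh (b - t) * Real.sinh (t - a) := by
    rw [← Real.sinh_add]; congr 1; ring
  have j1 := mul_le_mul_of_nonneg_right i1 (Real.sinh_nonneg_iff.2 hu)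
  have j2 := mul_le_mul_of_nonneg_right i2 (Real.sinh_nonneg_iff.2 hs)
  have j3 := mul_le_mul_of_nonneg_right i3 hL.le
  -- By the addition formula the two right-hand terms add up to a multiple of `sinh (b - a)`.
  -- Cancelling leaves `exp d ≤ 4 exp M`, the origin of `log 4`.
  have k : Real.exp (dist r (c t)) / 2 * Real.sinh (b - a)
      ≤ (2 * Real.exp M) * Real.sinh (b - a) := by
    rw [show (2 * Real.exp M) * Real.sinh (b - a) = Real.exp M * (2 * Real.cosh (t - a))
      * Real.sinh (b - t) + Real.exp M * (2 * Real.cosh (b - t)) * Real.sinh (t - a) by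
        rw [e]; ring]
    linarith
  have k' := le_of_mul_le_mul_right k hL
  rw [← Real.exp_le_exp, Real.exp_add, Real.exp_log (by norm_num)]
  linarith

/-- Take the point of the side `[x, y]` where both terms of the maximum in `dist_side_le`, seen from
`e`, equal the Gromov product of `x` and `y`. Going from `e` to `z` through it costs `log 4` twice,
which the factor `1 / 2` in the Gromov product reduces to one. -/
theorem IsCATNegOne.isGromovHyperbolic (hX : IsCATNegOne X) :
    IsGromovHyperbolic X (Real.log 4) := by
  intro e x z y
  obtain ⟨c, hc⟩ := hX.exists_geodesic x y
  have hlog : 0 ≤ Real.log 4 := Real.log_nonneg (by norm_num)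
  have t1 := dist_triangle e x y
  have t2 := dist_triangle e y x
  have t3 := dist_triangle x e y
  rw [dist_comm y x] at t2
  rw [dist_comm x e] at t3
  have ht : (dist x y + dist e x - dist e y) / 2 ∈ Icc 0 (dist x y) :=
    ⟨by linarith, by linarith⟩
  have h1 := hX.dist_side_le hc.isGeodesicOn ht e
  have h2 := hX.dist_side_le hc.isGeodesicOn ht z
  have h3 := dist_triangle_right e z (c ((dist x y + dist e x - dist e y) / 2))
  rw [hc.map_zero, hc.map_dist] at h1 h2
  unfold gromovProduct
  rw [dist_comm x z]
  rcases le_total (dist e x - ((dist x y + dist e x - dist e y) / 2 - 0))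
    (dist e y - (dist x y - (dist x y + dist e x - dist e y) / 2)) with k1 | k1 <;>
  rcases le_total (dist z x - ((dist x y + dist e x - dist e y) / 2 - 0))
    (dist z y - (dist x y - (dist x y + dist e x - dist e y) / 2)) with k2 | k2 <;>
  simp only [k1, k2, max_eq_left, max_eq_right] at h1 h2
  all_goals
    linarith [min_le_left ((dist e x + dist e z - dist z x) / 2)
      ((dist e z + dist e y - dist z y) / 2), min_le_right ((dist e x + dist e z - dist z x) / 2)
      ((dist e z + dist e y - dist z y) / 2)]

end Hyperbolic

/-! ### Local geodesics are geodesics, and geodesics extend to rays. -/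

section Extension

variable {X : Type*} [MetricSpace X]

/-- Two overlapping geodesics form a geodesic. -/
theorem IsCATNegOne.isGeodesicOn_union (hX : IsCATNegOne X) {c : ℝ → X} {a t h : ℝ} (hh : 0 < h)
    (hat : a ≤ t - h) (h1 : IsGeodesicOn c (Icc a t)) (h2 : IsGeodesicOn c (Icc (t - h) (t + h))) :
    IsGeodesicOn c (Icc a (t + h)) := by
  have S := hX.stewart h1 (t := t - h) ⟨hat, by linarith⟩ (c (t + h))
  have e1 : dist (c (t + h)) (c (t - h)) = 2 * h := by
    rw [h2 _ ⟨by linarith, le_rfl⟩ _ ⟨le_rfl, by linarith⟩, abs_of_nonneg (by linarith)]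
    ring
  have e2 : dist (c (t + h)) (c t) = h := by
    rw [h2 _ ⟨by linarith, le_rfl⟩ _ ⟨by linarith, by linarith⟩, abs_of_nonneg (by linarith)]
    ring
  rw [e1, e2, show t - (t - h) = h by ring, show t - h - a = (t - a) - h by ring] at S
  -- This is the equality case of Stewart, on a line. It forces the endpoints to be at least `(t -
  -- a) + h` apart, so all triangle inequalities in between are equalities.
  have id1 : Real.cosh (2 * h) * Real.sinh (t - a) - Real.cosh h * Real.sinh ((t - a) - h)
      = Real.cosh ((t - a) + h) * Real.sinh h := by
    rw [Real.cosh_two_mul, Real.sinh_sub (t - a) h, Real.cosh_add (t - a) h]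
    ring
  have hs : 0 < Real.sinh h := Real.sinh_pos_iff.2 hh
  have k : Real.cosh ((t - a) + h) ≤ Real.cosh (dist (c (t + h)) (c a)) :=
    le_of_mul_le_mul_right (by linarith) hs
  rw [Real.cosh_le_cosh, abs_of_nonneg (by linarith), abs_of_nonneg dist_nonneg] at k
  have key : ∀ s ∈ Icc a t, ∀ s' ∈ Icc t (t + h), dist (c s) (c s') = |s - s'| := by
    intro s hs s' hs'
    have d1 := h1 a ⟨le_rfl, by linarith⟩ s hs
    have d2 := h1 s hs t ⟨by linarith, le_rfl⟩
    have d3 := h2 t ⟨by linarith, by linarith⟩ s' ⟨by linarith [hs'.1], hs'.2⟩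
    have d4 := h2 s' ⟨by linarith [hs'.1], hs'.2⟩ (t + h) ⟨by linarith, le_rfl⟩
    rw [abs_of_nonpos (by linarith [hs.1])] at d1
    rw [abs_of_nonpos (by linarith [hs.2])] at d2
    rw [abs_of_nonpos (by linarith [hs'.1])] at d3
    rw [abs_of_nonpos (by linarith [hs'.2])] at d4
    rw [abs_of_nonpos (by linarith [hs.2, hs'.1])]
    have t1 := dist_triangle (c s) (c t) (c s')
    have t2 := dist_triangle4 (c a) (c s) (c s') (c (t + h))
    rw [dist_comm] at k
    apply le_antisymm <;> linarith
  intro s hs s' hs'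
  rcases le_total s t with q | q <;> rcases le_total s' t with q' | q'
  · exact h1 s ⟨hs.1, q⟩ s' ⟨hs'.1, q'⟩
  · exact key s ⟨hs.1, q⟩ s' ⟨q', hs'.2⟩
  · rw [dist_comm, abs_sub_comm]
    exact key s' ⟨hs'.1, q'⟩ s ⟨q, hs.2⟩
  · exact h2 s ⟨by linarith, hs.2⟩ s' ⟨by linarith, hs'.2⟩

/-- Local geodesics in `CAT(-1)` spaces are geodesics. -/
theorem IsCATNegOne.isGeodesicOn_of_isLocalGeodesicOn (hX : IsCATNegOne X) {c : ℝ → X} {a b : ℝ}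
    (hc : IsLocalGeodesicOn c (Icc a b)) : IsGeodesicOn c (Icc a b) := by
  choose! ε hε hc using hc
  obtain ⟨δ, hδ, H⟩ := lebesgue_number_lemma_of_metric (s := Icc a b) (ι := Icc a b)
    (c := fun t => Metric.ball (t : ℝ) (ε t)) isCompact_Icc (fun _ => Metric.isOpen_ball)
    (fun t ht => mem_iUnion.2 ⟨⟨t, ht⟩, Metric.mem_ball_self (hε t ht)⟩)
  have loc : ∀ t ∈ Icc a b, IsGeodesicOn c (Icc a b ∩ Metric.ball t δ) := by
    intro t ht
    obtain ⟨i, hi⟩ := H t ht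
    exact (hc i i.2).mono (inter_subset_inter_right _ hi)
  -- Advancing by at most half a Lebesgue number keeps an interval symmetric about the current
  -- endpoint inside one ball on which `c` is geodesic.
  have step : ∀ n : ℕ, IsGeodesicOn c (Icc a (min b (a + (n + 1) * (δ / 2)))) := by
    intro n
    induction n with
    | zero =>
      rcases lt_or_ge b a with hab | hab
      · rw [Icc_eq_empty (by simp [hab])]
        intro t ht
        exact ht.elim
      refine (loc a ⟨le_rfl, hab⟩).mono fun t ht => ⟨⟨ht.1, ht.2.trans (min_le_left _ _)⟩, ?_⟩
      have := ht.2.trans (min_le_right _ _)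
      simp only [Nat.cast_zero] at this
      rw [Metric.mem_ball, Real.dist_eq, abs_lt]
      constructor <;> linarith [ht.1]
    | succ n ih =>
      push_cast
      rcases le_or_gt b (a + (n + 1) * (δ / 2)) with hb | hb
      · refine ih.mono (Icc_subset_Icc_right ?_)
        rw [min_eq_left hb]
        exact min_le_left _ _
      · rw [min_eq_right hb.le] at ih
        obtain ⟨t, ht⟩ : ∃ t, t = a + (n + 1) * (δ / 2) := ⟨_, rfl⟩
        obtain ⟨h, hh⟩ : ∃ h, h = min (δ / 2) (b - t) := ⟨_, rfl⟩
        rw [← ht] at ih hb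
        have hta : a + δ / 2 ≤ t := by
          rw [ht]
          have : (0 : ℝ) ≤ n := n.cast_nonneg
          nlinarith
        have hh0 : 0 < h := by rw [hh, lt_min_iff]; constructor <;> linarith
        have hh1 : h ≤ δ / 2 := by rw [hh]; exact min_le_left _ _
        have hh2 : h ≤ b - t := by rw [hh]; exact min_le_right _ _
        have := hX.isGeodesicOn_union hh0 (by linarith) ih
          ((loc t ⟨by linarith, hb.le⟩).mono fun s hs => ⟨⟨by linarith [hs.1], by linarith [hs.2]⟩,
            by rw [Metric.mem_ball, Real.dist_eq, abs_lt]; constructor <;> linarith [hs.1, hs.2]⟩)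
        refine this.mono (Icc_subset_Icc_right ?_)
        rw [hh, ← min_add_add_left, min_comm]
        refine le_min ((min_le_left _ _).trans ?_) ((min_le_right _ _).trans ?_) <;> linarith
  obtain ⟨n, hn⟩ := exists_nat_gt ((b - a) / (δ / 2))
  refine (step n).mono (Icc_subset_Icc_right (le_min le_rfl ?_))
  rw [div_lt_iff₀ (by linarith)] at hn
  linarith

/-- A geodesic on a half-open interval extends to the closed interval. -/
theorem IsGeodesicOn.exists_Icc [CompleteSpace X] {g : ℝ → X} {B : ℝ} (hB : 0 < B)
    (hg : IsGeodesicOn g (Ico 0 B)) :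
    ∃ g' : ℝ → X, IsGeodesicOn g' (Icc 0 B) ∧ EqOn g g' (Ico 0 B) := by
  obtain ⟨u, -, hu, hlim⟩ := exists_seq_strictMono_tendsto' hB
  have hu' : ∀ n, u n ∈ Ico 0 B := fun n => ⟨(hu n).1.le, (hu n).2⟩
  have hC : CauchySeq (g ∘ u) := by
    rw [Metric.cauchySeq_iff]
    intro ε hε
    obtain ⟨N, hN⟩ := Metric.cauchySeq_iff.1 hlim.cauchySeq ε hε
    refine ⟨N, fun m hm n hn => ?_⟩
    rw [Function.comp, Function.comp, hg _ (hu' m) _ (hu' n), ← Real.dist_eq]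
    exact hN m hm n hn
  obtain ⟨y, hy⟩ := cauchySeq_tendsto_of_complete hC
  have key : ∀ s ∈ Ico 0 B, dist (g s) y = |s - B| := by
    intro s hs
    have l1 : Tendsto (fun n => dist (g s) (g (u n))) atTop (𝓝 (dist (g s) y)) :=
      tendsto_const_nhds.dist hy
    have l2 : Tendsto (fun n => |s - u n|) atTop (𝓝 |s - B|) := (tendsto_const_nhds.sub hlim).abs
    exact tendsto_nhds_unique l1 (l2.congr fun n => (hg s hs _ (hu' n)).symm)
  refine ⟨Function.update g B y, ?_, fun s hs => (Function.update_of_ne hs.2.ne _ _).symm⟩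
  intro s hs t ht
  rcases hs.2.eq_or_lt with q | q <;> rcases ht.2.eq_or_lt with q' | q'
  · rw [q, q', dist_self, sub_self, abs_zero]
  · rw [q, Function.update_self, Function.update_of_ne q'.ne, dist_comm, key t ⟨ht.1, q'⟩,
      abs_sub_comm]
  · rw [q', Function.update_self, Function.update_of_ne q.ne, key s ⟨hs.1, q⟩]
  · rw [Function.update_of_ne q.ne, Function.update_of_ne q'.ne]
    exact hg s ⟨hs.1, q⟩ t ⟨ht.1, q'⟩

/-- Every nontrivial geodesic extends to a geodesic ray. -/
theorem IsCATNegOne.exists_ray [CompleteSpace X] (hX : IsCATNegOne X)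
    (hE : GeodesicExtensionProperty X) {c : ℝ → X} {l : ℝ} (hl : 0 < l)
    (hc : IsGeodesicOn c (Icc 0 l)) :
    ∃ g : ℝ → X, IsGeodesicOn g (Ici 0) ∧ EqOn c g (Icc 0 l) := by
  by_contra hno
  -- Zorn's lemma on extensions to `[0, x.1]`. The relation ignores values outside the interval, so
  -- it is only a preorder.
  let α := {x : ℝ × (ℝ → X) // l ≤ x.1 ∧ IsGeodesicOn x.2 (Icc 0 x.1) ∧ EqOn c x.2 (Icc 0 l)}
  let r : α → α → Prop := fun x y => x.1.1 ≤ y.1.1 ∧ EqOn x.1.2 y.1.2 (Icc 0 x.1.1)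
  have hbound : ∀ S : Set α, IsChain r S → ∃ ub, ∀ x ∈ S, r x ub := by
    intro S hS
    rcases S.eq_empty_or_nonempty with rfl | ⟨x₀, hx₀⟩
    · exact ⟨⟨(l, c), le_rfl, hc, fun _ _ => rfl⟩, fun x hx => hx.elim⟩
    have cons : ∀ x ∈ S, ∀ y ∈ S, ∀ t, 0 ≤ t → t ≤ x.1.1 → t ≤ y.1.1 → x.1.2 t = y.1.2 t := by
      intro x hx y hy t h0 h1 h2
      rcases eq_or_ne x y with rfl | hxy
      · rfl
      rcases hS hx hy hxy with h | h
      · exact h.2 ⟨h0, h1⟩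
      · exact (h.2 ⟨h0, h2⟩).symm
    classical
    let g : ℝ → X := fun t => if h : ∃ x ∈ S, t ≤ x.1.1 then h.choose.1.2 t else c 0
    have hgx : ∀ x ∈ S, EqOn x.1.2 g (Icc 0 x.1.1) := by
      intro x hx t ht
      have h : ∃ x ∈ S, t ≤ x.1.1 := ⟨x, hx, ht.2⟩
      have : g t = h.choose.1.2 t := dif_pos h
      rw [this]
      exact cons x hx _ h.choose_spec.1 t ht.1 ht.2 h.choose_spec.2
    have hgl : EqOn c g (Icc 0 l) := fun t ht =>
      (x₀.2.2.2 ht).trans (hgx x₀ hx₀ ⟨ht.1, ht.2.trans x₀.2.1⟩)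
    have hg : IsGeodesicOn g {t | 0 ≤ t ∧ ∃ x ∈ S, t ≤ x.1.1} := by
      rintro t ⟨h0, x, hx, htx⟩ t' ⟨h0', x', hx', htx'⟩
      obtain ⟨z, hz, h1, h2⟩ : ∃ z ∈ S, x.1.1 ≤ z.1.1 ∧ x'.1.1 ≤ z.1.1 := by
        rcases le_total x.1.1 x'.1.1 with h | h
        · exact ⟨x', hx', h, le_rfl⟩
        · exact ⟨x, hx, le_rfl, h⟩
      exact (z.2.2.1.congr (hgx z hz)) t ⟨h0, htx.trans h1⟩ t' ⟨h0', htx'.trans h2⟩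
    -- A chain of unbounded length would glue to a ray, contrary to `hno`; a bounded chain whose
    -- supremum is not attained is closed up by completeness.
    by_cases hun : ∀ t, ∃ x ∈ S, t ≤ x.1.1
    · exact (hno ⟨g, hg.mono fun t ht => ⟨ht, hun t⟩, hgl⟩).elim
    push Not at hun
    obtain ⟨M, hM⟩ := hun
    have hbdd : BddAbove ((fun x : α => x.1.1) '' S) :=
      ⟨M, by rintro _ ⟨x, hx, rfl⟩; exact (hM x hx).le⟩
    have hne : ((fun x : α => x.1.1) '' S).Nonempty := ⟨_, x₀, hx₀, rfl⟩
    obtain ⟨B, hB⟩ : ∃ B, B = sSup ((fun x : α => x.1.1) '' S) := ⟨_, rfl⟩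
    have hxB : ∀ x ∈ S, x.1.1 ≤ B := fun x hx => hB ▸ le_csSup hbdd ⟨x, hx, rfl⟩
    by_cases hatt : ∃ x ∈ S, B ≤ x.1.1
    · obtain ⟨x, hx, hBx⟩ := hatt
      have hle : ∀ y ∈ S, y.1.1 ≤ x.1.1 := fun y hy => (hxB y hy).trans hBx
      exact ⟨x, fun y hy => ⟨hle y hy, fun t ht =>
        cons y hy x hx t ht.1 ht.2 (ht.2.trans (hle y hy))⟩⟩
    push Not at hatt
    have hlB : l < B := x₀.2.1.trans_lt (hatt x₀ hx₀)
    obtain ⟨g', hg', heq⟩ := IsGeodesicOn.exists_Icc (hl.trans hlB) (hg.mono fun t ht => by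
      obtain ⟨_, ⟨x, hx, rfl⟩, hxt⟩ := exists_lt_of_lt_csSup hne (hB ▸ ht.2)
      exact ⟨ht.1, x, hx, hxt.le⟩)
    refine ⟨⟨(B, g'), hlB.le, hg', fun t ht => (hgl ht).trans (heq ⟨ht.1, ht.2.trans_lt hlB⟩)⟩,
      fun x hx => ⟨hxB x hx, fun t ht => (hgx x hx ht).trans (heq ⟨ht.1, ht.2.trans_lt (hatt x hx)⟩)⟩⟩
  obtain ⟨m, hm⟩ := exists_maximal_of_chains_bounded hbound (fun {x y z} h h' =>
    ⟨h.1.trans h'.1, fun t ht => (h.2 ht).trans (h'.2 ⟨ht.1, ht.2.trans h.1⟩)⟩)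
  obtain ⟨ε, hε, c', hc', heq⟩ := hE 0 m.1.1 m.1.2 (hl.trans_le m.2.1)
    (fun t _ => ⟨1, one_pos, m.2.2.1.mono inter_subset_left⟩)
  have := hm ⟨(m.1.1 + ε, c'), by linarith [m.2.1], hX.isGeodesicOn_of_isLocalGeodesicOn hc',
    fun t ht => (m.2.2.2 ht).trans (heq ⟨ht.1, ht.2.trans m.2.1⟩)⟩ ⟨by simpa using hε.le, heq⟩
  have := this.1
  simp only at this
  linarith

end Extension

/-! ### Angles, opposite directions and diverging rays. -/

section Angles

variable {X : Type*} [MetricSpace X]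

/-- The difference is `2 sinh ((d + e) / 2) sinh ((d - e) / 2)`, and `x ≤ sinh x`. This turns
hyperbolic estimates into estimates of Euclidean comparison angles. -/
theorem Real.sq_sub_sq_le_cosh_sub_cosh {d e : ℝ} (he : 0 ≤ e) (hed : e ≤ d) :
    (d ^ 2 - e ^ 2) / 2 ≤ Real.cosh d - Real.cosh e := by
  have h : Real.cosh d - Real.cosh e = 2 * (Real.sinh ((d + e) / 2) * Real.sinh ((d - e) / 2)) := by
    rw [show Real.cosh d = Real.cosh ((d + e) / 2 + (d - e) / 2) by congr 1; ring,
      show Real.cosh e = Real.cosh ((d + e) / 2 - (d - e) / 2) by congr 1; ring,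
      Real.cosh_add, Real.cosh_sub]
    ring
  have h1 : (d + e) / 2 ≤ Real.sinh ((d + e) / 2) := Real.self_le_sinh_iff.2 (by linarith)
  have h2 : (d - e) / 2 ≤ Real.sinh ((d - e) / 2) := Real.self_le_sinh_iff.2 (by linarith)
  have := mul_le_mul h1 h2 (by linarith) (by linarith)
  rw [h]
  linarith

/-- The hyperbolic comparison angle decreases when one side is shortened. -/
theorem IsCATNegOne.comparison_shorten (hX : IsCATNegOne X) {c : ℝ → X} {s s' : ℝ} {r : X}
    (hc : IsGeodesicOn c (Icc 0 s)) (hs' : 0 ≤ s') (hss' : s' ≤ s) :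
    (Real.cosh s * Real.cosh (dist r (c 0)) - Real.cosh (dist r (c s))) * Real.sinh s'
      ≤ (Real.cosh s' * Real.cosh (dist r (c 0)) - Real.cosh (dist r (c s'))) * Real.sinh s := by
  have S := hX.stewart hc ⟨hs', hss'⟩ r
  rw [sub_zero, sub_zero, Real.sinh_sub] at S
  linarith

/-- The hyperbolic theorem of Pythagoras, as an inequality. -/
theorem IsCATNegOne.pythagoras (hX : IsCATNegOne X) {p : X} {v w : GeodesicFrom p}
    (hvw : Real.pi / 2 ≤ alexandrovAngle v w) {g g' : ℝ → X} (hg : IsGeodesicOn g (Ici 0))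
    (hg' : IsGeodesicOn g' (Ici 0)) (hv : EqOn v.toFun g (Icc 0 v.length))
    (hw : EqOn w.toFun g' (Icc 0 w.length)) {s t : ℝ} (hs : 0 < s) (ht : 0 < t) :
    Real.cosh s * Real.cosh t ≤ Real.cosh (dist (g s) (g' t)) := by
  have hg0 : g 0 = p := by rw [← hv ⟨le_rfl, v.length_pos.le⟩, v.map_zero]
  have hg0' : g' 0 = p := by rw [← hw ⟨le_rfl, w.length_pos.le⟩, w.map_zero]
  have dg : ∀ τ, 0 ≤ τ → dist (g τ) p = τ := fun τ hτ => by
    rw [← hg0, hg τ hτ 0 self_mem_Ici, sub_zero, abs_of_nonneg hτ]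
  have dg' : ∀ τ, 0 ≤ τ → dist (g' τ) p = τ := fun τ hτ => by
    rw [← hg0', hg' τ hτ 0 self_mem_Ici, sub_zero, abs_of_nonneg hτ]
  by_contra! hlt
  have hss : 0 < Real.sinh s := Real.sinh_pos_iff.2 hs
  have hst : 0 < Real.sinh t := Real.sinh_pos_iff.2 ht
  -- The cosine of the hyperbolic comparison angle at `p`. If positive, it stays at least `η` when
  -- the two sides are shortened, one after the other.
  obtain ⟨η, hη⟩ : ∃ η, η = (Real.cosh s * Real.cosh t - Real.cosh (dist (g s) (g' t)))
    / (Real.sinh s * Real.sinh t) := ⟨_, rfl⟩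
  have hη0 : 0 < η := by rw [hη]; exact div_pos (by linarith) (by positivity)
  have hηe : Real.cosh s * Real.cosh t - Real.cosh (dist (g s) (g' t))
      = η * (Real.sinh s * Real.sinh t) := by rw [hη]; field_simp
  have key : ∀ s' t', 0 < s' → s' ≤ s → 0 < t' → t' ≤ t →
      Real.cosh (dist (g s') (g' t')) ≤ Real.cosh s' * Real.cosh t'
        - η * (Real.sinh s' * Real.sinh t') := by
    intro s' t' hs0 hs1 ht0 ht1
    have c1 := hX.comparison_shorten (r := g' t) (IsGeodesicOn.mono hg (t := Ici 0) (s := Icc 0 s) Icc_subset_Ici_self)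
      hs0.le hs1
    have c2 := hX.comparison_shorten (r := g s') (IsGeodesicOn.mono hg' (t := Ici 0) (s := Icc 0 t) Icc_subset_Ici_self)
      ht0.le ht1
    rw [hg0, dg' t ht.le, dist_comm _ (g s), dist_comm _ (g s'), hηe] at c1
    rw [hg0', dg s' hs0.le] at c2
    have c1' : η * (Real.sinh t * Real.sinh s')
        ≤ Real.cosh s' * Real.cosh t - Real.cosh (dist (g s') (g' t)) :=
      le_of_mul_le_mul_right (by linarith) hss
    have hst' : 0 < Real.sinh t' := Real.sinh_pos_iff.2 ht0
    have c3 := mul_le_mul_of_nonneg_right c1' hst'.le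
    have : η * (Real.sinh s' * Real.sinh t')
        ≤ Real.cosh t' * Real.cosh s' - Real.cosh (dist (g s') (g' t')) :=
      le_of_mul_le_mul_right (by linarith) hst
    linarith
  -- small parameters
  have hη1 : η ≤ 1 := by
    have h1 : Real.cosh (s - t) ≤ Real.cosh (dist (g s) (g' t)) := by
      rw [Real.cosh_le_cosh, abs_of_nonneg (dist_nonneg (x := g s)), abs_le]
      have t1 := dist_triangle (g s) (g' t) p
      have t2 := dist_triangle_left (g' t) p (g s)
      rw [dg s hs.le, dg' t ht.le] at *
      constructor <;> linarith
    rw [Real.cosh_sub] at h1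
    by_contra! h
    have : 0 < Real.sinh s * Real.sinh t := by positivity
    nlinarith
  have hlim : Tendsto (fun τ : ℝ => Real.sinh τ / τ) (𝓝[>] 0) (𝓝 1) := by
    have h := (Real.hasDerivAt_sinh 0).tendsto_slope
    simp only [Real.cosh_zero] at h
    refine (h.mono_left (nhdsWithin_mono _ fun x hx => ne_of_gt hx)).congr fun τ => ?_
    rw [slope_def_field, Real.sinh_zero, sub_zero, sub_zero]
  -- A lower bound for the cosine of the Euclidean comparison angle. Its limit `η` keeps the
  -- Alexandrov angle below `π / 2`.
  have hlim2 : Tendsto (fun z : ℝ × ℝ => 1 - (1 - η) * ((Real.sinh z.1 / z.1)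
      * (Real.sinh z.2 / z.2))) (𝓝[>] 0 ×ˢ 𝓝[>] 0) (𝓝 η) := by
    have l1 := hlim.comp (tendsto_fst (f := 𝓝[>] (0 : ℝ)) (g := 𝓝[>] (0 : ℝ)))
    have l2 := hlim.comp (tendsto_snd (f := 𝓝[>] (0 : ℝ)) (g := 𝓝[>] (0 : ℝ)))
    simpa using ((l1.mul l2).const_mul (1 - η)).const_sub 1
  have ev := hlim2.eventually (lt_mem_nhds (by linarith : η / 2 < η))
  have e1 := eventually_mem_Ioo_nhdsGT (lt_min hs v.length_pos)
  have e2 := eventually_mem_Ioo_nhdsGT (lt_min ht w.length_pos)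
  have hle : alexandrovAngle v w ≤ Real.arccos (η / 2) := by
    refine limsup_le_of_le (isBoundedUnder_comparisonAngle' v w _).isCoboundedUnder_le ?_
    filter_upwards [ev, e1.prod_mk e2] with z hz hz'
    obtain ⟨⟨a1, a2⟩, b1, b2⟩ := hz'
    rw [lt_min_iff] at a2 b2
    refine Real.arccos_le_arccos ?_
    rw [v.dist_eq a1 a2.2.le, w.dist_eq b1 b2.2.le, hv ⟨a1.le, a2.2.le⟩, hw ⟨b1.le, b2.2.le⟩]
    have k := key z.1 z.2 a1 a2.1.le b1 b2.1.le
    have hd : |z.1 - z.2| ≤ dist (g z.1) (g' z.2) := by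
      have t1 := dist_triangle (g z.1) (g' z.2) p
      have t2 := dist_triangle_left (g' z.2) p (g z.1)
      rw [dg _ a1.le, dg' _ b1.le] at *
      rw [abs_le]
      constructor <;> linarith
    have q := Real.sq_sub_sq_le_cosh_sub_cosh (abs_nonneg _) hd
    rw [Real.cosh_abs, sq_abs, Real.cosh_sub] at q
    rw [le_div_iff₀ (by positivity)]
    have m := mul_le_mul_of_nonneg_right hz.le (by positivity : 0 ≤ 2 * z.1 * z.2)
    have e : (1 - (1 - η) * (Real.sinh z.1 / z.1 * (Real.sinh z.2 / z.2))) * (2 * z.1 * z.2)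
        = 2 * z.1 * z.2 - 2 * (1 - η) * (Real.sinh z.1 * Real.sinh z.2) := by
      field_simp
    rw [e] at m
    linarith
  have : Real.arccos (η / 2) < Real.pi / 2 := Real.arccos_lt_pi_div_two.2 (by linarith)
  linarith

/-- Rays enclosing an angle of at least `π / 2` diverge. -/
theorem IsCATNegOne.dist_ge_of_angle (hX : IsCATNegOne X) {p : X} {v w : GeodesicFrom p}
    (hvw : Real.pi / 2 ≤ alexandrovAngle v w) {g g' : ℝ → X} (hg : IsGeodesicOn g (Ici 0))
    (hg' : IsGeodesicOn g' (Ici 0)) (hv : EqOn v.toFun g (Icc 0 v.length))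
    (hw : EqOn w.toFun g' (Icc 0 w.length)) {s t : ℝ} (hs : 0 ≤ s) (ht : 0 ≤ t) :
    s + t - Real.log 4 ≤ dist (g s) (g' t) := by
  have hlog : 0 ≤ Real.log 4 := Real.log_nonneg (by norm_num)
  have h0 : g 0 = g' 0 := by
    rw [← hv ⟨le_rfl, v.length_pos.le⟩, v.map_zero, ← hw ⟨le_rfl, w.length_pos.le⟩, w.map_zero]
  rcases hs.eq_or_lt with rfl | hs
  · rw [h0, hg' 0 self_mem_Ici t ht, zero_sub, abs_neg, abs_of_nonneg ht]
    linarith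
  rcases ht.eq_or_lt with rfl | ht
  · rw [← h0, hg s hs.le 0 self_mem_Ici, sub_zero, abs_of_nonneg hs.le]
    linarith
  have h := hX.pythagoras hvw hg hg' hv hw hs ht
  have i1 : Real.exp s / 2 ≤ Real.cosh s := by
    rw [Real.cosh_eq]; linarith [Real.exp_pos (-s)]
  have i2 : Real.exp t / 2 ≤ Real.cosh t := by
    rw [Real.cosh_eq]; linarith [Real.exp_pos (-t)]
  have i3 : Real.cosh (dist (g s) (g' t)) ≤ Real.exp (dist (g s) (g' t)) := by
    have : Real.exp (-dist (g s) (g' t)) ≤ Real.exp (dist (g s) (g' t)) :=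
      Real.exp_le_exp.2 (by linarith [dist_nonneg (x := g s) (y := g' t)])
    rw [Real.cosh_eq]
    linarith
  have i4 := mul_le_mul i1 i2 (by positivity) (Real.cosh_pos s).le
  rw [← Real.exp_le_exp, Real.exp_sub, Real.exp_add, Real.exp_log (by norm_num)]
  linarith

/-- Traverse `v` backwards and extend it beyond `p`. The result is a geodesic through `p`, so all
comparison angles near `p` are exactly `π`. -/
theorem IsCATNegOne.exists_opposite (hX : IsCATNegOne X) (hE : GeodesicExtensionProperty X) {p : X}
    (v : GeodesicFrom p) : ∃ w : GeodesicFrom p, alexandrovAngle v w = Real.pi := by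
  have h1 : IsGeodesicOn (fun t => v.toFun (-t)) (Icc (-v.length) 0) := by
    intro s hs t ht
    rw [v.isGeodesicOn _ ⟨by linarith [hs.2], by linarith [hs.1]⟩ _
      ⟨by linarith [ht.2], by linarith [ht.1]⟩, abs_sub_comm]
    congr 1
    ring
  obtain ⟨ε, hε, c, hc, heq⟩ := hE (-v.length) 0 _ (by linarith [v.length_pos])
    (fun t _ => ⟨1, one_pos, h1.mono inter_subset_left⟩)
  have hc := hX.isGeodesicOn_of_isLocalGeodesicOn hc
  rw [zero_add] at hc
  have hl := v.length_pos
  let w : GeodesicFrom p := ⟨c, ε, hε, by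
    rw [← heq ⟨by linarith, le_rfl⟩]
    simp [v.map_zero], hc.mono (Icc_subset_Icc_left (by linarith))⟩
  refine ⟨w, ?_⟩
  have h : ∀ᶠ z in 𝓝[>] (0 : ℝ) ×ˢ 𝓝[>] (0 : ℝ),
      comparisonAngle p (v.toFun z.1) (w.toFun z.2) = Real.pi := by
    filter_upwards [(eventually_mem_Ioo_nhdsGT v.length_pos).prod_mk
      (eventually_mem_Ioo_nhdsGT w.length_pos)] with z hz
    obtain ⟨⟨a1, a2⟩, b1, b2⟩ := hz
    have hb : z.2 < ε := b2
    have hd : dist (v.toFun z.1) (w.toFun z.2) = z.1 + z.2 := by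
      have : v.toFun z.1 = c (-z.1) := by
        rw [← heq ⟨by linarith, by linarith⟩]
        simp only [neg_neg]
      rw [this]
      change dist (c (-z.1)) (c z.2) = _
      rw [hc _ ⟨by linarith, by linarith⟩ _ ⟨by linarith, hb.le⟩, abs_of_neg (by linarith)]
      ring
    unfold comparisonAngle
    rw [v.dist_eq a1 a2.le, w.dist_eq b1 b2.le, hd, Real.arccos_eq_pi,
      div_le_iff₀ (by positivity)]
    linarith
  unfold alexandrovAngle
  rw [limsup_congr h, limsup_const]

/-- Three geodesic rays issuing from a point diverge pairwise. -/
theorem IsCATNegOne.exists_three_rays [CompleteSpace X] [Nontrivial X] (hX : IsCATNegOne X)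
    (hE : GeodesicExtensionProperty X) (p : X) [PreconnectedSpace (SpaceOfDirections p)] :
    ∃ g : Fin 3 → ℝ → X, (∀ i, g i 0 = p) ∧ (∀ i, IsGeodesicOn (g i) (Ici 0)) ∧
      ∀ i j, i ≠ j → ∀ s t, 0 ≤ s → 0 ≤ t → s + t - Real.log 4 ≤ dist (g i s) (g j t) := by
  obtain ⟨q, hq⟩ := exists_ne p
  obtain ⟨c, hc⟩ := hX.exists_geodesic p q
  let v : GeodesicFrom p := ⟨c, dist p q, dist_pos.2 hq.symm, hc.map_zero, hc.isGeodesicOn⟩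
  obtain ⟨w, hw⟩ := hX.exists_opposite hE v
  have hpi := Real.pi_pos
  -- Intermediate value theorem: the angle with `v` is `0` at `v` and `π` at `w`.
  obtain ⟨u', hu'⟩ : Real.pi / 2 ∈ range fun z : SpaceOfDirections p =>
      dist (SeparationQuotient.mk v) z := by
    refine mem_range_of_exists_le_of_exists_ge (continuous_const.dist continuous_id)
      ⟨SeparationQuotient.mk v, by rw [dist_self]; positivity⟩ ⟨SeparationQuotient.mk w, ?_⟩
    rw [SeparationQuotient.dist_mk]
    change _ ≤ alexandrovAngle v w
    rw [hw]
    linarith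
  obtain ⟨u, rfl⟩ := SeparationQuotient.surjective_mk u'
  simp only [SeparationQuotient.dist_mk] at hu'
  change alexandrovAngle v u = _ at hu'
  have huw : Real.pi / 2 ≤ alexandrovAngle u w := by
    have := alexandrovAngle_triangle v u w
    linarith
  let d : Fin 3 → GeodesicFrom p := ![v, u, w]
  have hd : ∀ i j, i < j → Real.pi / 2 ≤ alexandrovAngle (d i) (d j) := by
    intro i j hij
    fin_cases i <;> fin_cases j <;> simp_all [d]
    linarith
  have hd' : ∀ i j, i ≠ j → Real.pi / 2 ≤ alexandrovAngle (d i) (d j) := by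
    intro i j hij
    rcases lt_or_gt_of_ne hij with h | h
    · exact hd i j h
    · rw [alexandrovAngle_comm]
      exact hd j i h
  choose g hg hdg using fun i => hX.exists_ray hE (d i).length_pos (d i).isGeodesicOn
  refine ⟨g, fun i => ?_, hg, fun i j hij s t hs ht =>
    hX.dist_ge_of_angle (hd' i j hij) (hg i) (hg j) (hdg i) (hdg j) hs ht⟩
  rw [← hdg i ⟨le_rfl, (d i).length_pos.le⟩, (d i).map_zero]

end Angles

/-! ### The Morse lemma for quasi-geodesic sequences. -/

section Morse

variable {X : Type*} [MetricSpace X]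

/-- The four point condition for a chain of `2 ^ k` points. -/
theorem IsGromovHyperbolic.chain {δ : ℝ} (hX : IsGromovHyperbolic X δ) (hδ : 0 ≤ δ) (u : ℕ → X)
    (e : X) (G : ℝ) (k : ℕ) : ∀ i n : ℕ, n ≤ 2 ^ k → (∀ j ≤ i + n, G ≤ dist e (u j)) →
      (∀ j < i + n, G ≤ gromovProduct e (u j) (u (j + 1))) →
      G - k * δ ≤ gromovProduct e (u i) (u (i + n)) := by
  induction k with
  | zero =>
    intro i n hn h0 h1
    rw [Nat.cast_zero, zero_mul, sub_zero]
    rw [pow_zero] at hn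
    interval_cases n
    · rw [add_zero, gromovProduct_self]
      exact h0 i (by omega)
    · exact h1 i (by omega)
  | succ k ih =>
    intro i n hn h0 h1
    push_cast
    rcases le_or_gt n (2 ^ k) with h | h
    · linarith [ih i n h h0 h1]
    · have a1 := ih i (2 ^ k) le_rfl (fun j hj => h0 j (by omega)) (fun j hj => h1 j (by omega))
      have a2 := ih (i + 2 ^ k) (n - 2 ^ k) (by rw [pow_succ] at hn; omega)
        (fun j hj => h0 j (by omega)) (fun j hj => h1 j (by omega))
      rw [show i + 2 ^ k + (n - 2 ^ k) = i + n by omega] at a2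
      linarith [hX e (u i) (u (i + 2 ^ k)) (u (i + n)), le_min a1 a2]

theorem exists_linear_le_two_pow (a b : ℝ) : ∃ k₀ : ℕ, ∀ k ≥ k₀, a * k + b ≤ (2 : ℝ) ^ k := by
  have h1 := (tendsto_pow_const_div_const_pow_of_one_lt 1 (one_lt_two (α := ℝ))).const_mul a
  have h0 := (tendsto_pow_const_div_const_pow_of_one_lt 0 (one_lt_two (α := ℝ))).const_mul b
  have h := h1.add h0
  simp only [mul_zero, add_zero, pow_one, pow_zero] at h
  obtain ⟨k₀, hk⟩ := eventually_atTop.1 (h.eventually (gt_mem_nhds (one_pos (α := ℝ))))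
  refine ⟨k₀, fun k hk' => ?_⟩
  have := hk k hk'
  have hp : (0 : ℝ) < 2 ^ k := by positivity
  rw [mul_div_assoc', mul_div_assoc', ← add_div, div_lt_one hp] at this
  linarith

/-- A number that is bounded by the logarithm of a linear function of it is bounded. -/
theorem exists_bound_of_le_log {a : ℝ} (b S : ℝ) {δ : ℝ} (ha : 0 ≤ a) (hδ : 0 < δ) :
    ∃ D₀ : ℝ, 0 ≤ D₀ ∧ ∀ D : ℝ, (∀ k : ℕ, a * D + b ≤ (2 : ℝ) ^ k → D ≤ S + k * δ) → D ≤ D₀ := by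
  obtain ⟨k₀, hk₀⟩ := exists_linear_le_two_pow (a * δ) (a * (S + δ) + b)
  refine ⟨max 0 (S + k₀ * δ), le_max_left _ _, fun D hD => ?_⟩
  by_contra! hlt
  have hlt := (le_max_right _ _).trans_lt hlt
  -- With `k = m - 1`, `D` lies in `(S + k δ, S + (k + 1) δ]`: the upper bound makes `a D + b`
  -- linear in `k`, hence at most `2 ^ k`, and the lower bound contradicts the hypothesis.
  obtain ⟨m, hm⟩ : ∃ m, m = ⌈(D - S) / δ⌉₊ := ⟨_, rfl⟩
  have hk : (k₀ : ℝ) < (D - S) / δ := by rw [lt_div_iff₀ hδ]; linarith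
  have hpos : 0 < (D - S) / δ := lt_of_le_of_lt k₀.cast_nonneg hk
  have h1 : (D - S) / δ ≤ m := hm ▸ Nat.le_ceil _
  have h2 : (m : ℝ) < (D - S) / δ + 1 := hm ▸ Nat.ceil_lt_add_one hpos.le
  have hkm : k₀ < m := by exact_mod_cast hk.trans_le h1
  obtain ⟨k, rfl⟩ : ∃ k, m = k + 1 := ⟨m - 1, by omega⟩
  push_cast at h1 h2
  have h1' : D - S ≤ (k + 1) * δ := (div_le_iff₀ hδ).1 h1
  have h2' : k * δ < D - S := (lt_div_iff₀ hδ).1 (by linarith)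
  have := hD k ((by nlinarith : a * D + b ≤ a * δ * k + (a * (S + δ) + b)).trans
    (hk₀ k (by omega)))
  linarith

/-- The sequence `u` is a quasi-geodesic on `{0, …, n}`. -/
structure IsQuasiGeodesicSeq (K B : ℝ) (u : ℕ → X) (n : ℕ) : Prop where
  le_dist : ∀ i ≤ n, ∀ j ≤ n, |(i : ℝ) - j| ≤ K * (dist (u i) (u j) + B)
  dist_le : ∀ i ≤ n, ∀ j ≤ n, dist (u i) (u j) ≤ K * |(i : ℝ) - j| + B

theorem IsGeodesicOn.continuousOn {c : ℝ → X} {s : Set ℝ} (hc : IsGeodesicOn c s) :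
    ContinuousOn c s := by
  have : LipschitzOnWith 1 c s := LipschitzOnWith.of_dist_le_mul fun x hx y hy => by
    rw [hc x hx y hy, Real.dist_eq, NNReal.coe_one, one_mul]
  exact this.continuousOn

/-- A geodesic stays close to a quasi-geodesic with the same endpoints. -/
theorem exists_geodesic_near_quasiGeodesic {K δ : ℝ} (B : ℝ) (hK : 0 ≤ K) (hδ : 0 < δ) :
    ∃ D₀ : ℝ, 0 ≤ D₀ ∧ ∀ (X : Type*) [MetricSpace X], IsGromovHyperbolic X δ →
      ∀ (u : ℕ → X) (n : ℕ), IsQuasiGeodesicSeq K B u n →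
      ∀ (c : ℝ → X), IsGeodesicFromTo c (u 0) (u n) →
      ∀ t ∈ Icc 0 (dist (u 0) (u n)), ∃ i ≤ n, dist (c t) (u i) ≤ D₀ := by
  -- Points of `u` at most `6 D` apart have indices at most `K (6 D + B)` apart. Jumps of length at
  -- most `K + B` cost `(K + B) / 2`, and attaching both ends of the detour costs `2 δ`.
  obtain ⟨D₀, hD₀, H⟩ := exists_bound_of_le_log (a := 6 * K) (K * B) ((K + B) / 2 + 2 * δ)
    (by positivity) hδ
  refine ⟨D₀, hD₀, fun X _ hX u n hu c hc => ?_⟩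
  set l := dist (u 0) (u n) with hl
  have hl0 : 0 ≤ l := dist_nonneg
  set T := u '' Iic n with hT
  have hTc : IsCompact T := ((finite_Iic n).image u).isCompact
  have hTn : T.Nonempty := ⟨u 0, 0, Nat.zero_le n, rfl⟩
  have near : ∀ z, ∃ i ≤ n, Metric.infDist z T = dist z (u i) := by
    intro z
    obtain ⟨_, ⟨i, hi, rfl⟩, h⟩ := hTc.exists_infDist_eq_dist hTn z
    exact ⟨i, hi, h⟩
  have far : ∀ z, ∀ i ≤ n, Metric.infDist z T ≤ dist z (u i) := fun z i hi =>
    Metric.infDist_le_dist_of_mem ⟨i, hi, rfl⟩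
  obtain ⟨t₀, ht₀, hmax⟩ := isCompact_Icc.exists_isMaxOn (nonempty_Icc.2 hl0)
    ((Metric.continuous_infDist_pt T).comp_continuousOn hc.isGeodesicOn.continuousOn)
  set D := Metric.infDist (c t₀) T with hD
  have hmax : ∀ t ∈ Icc 0 l, Metric.infDist (c t) T ≤ D := fun t ht => hmax ht
  have hD0 : 0 ≤ D := Metric.infDist_nonneg
  suffices h : D ≤ D₀ by
    intro t ht
    obtain ⟨i, hi, e⟩ := near (c t)
    exact ⟨i, hi, by linarith [hmax t ht]⟩
  -- points of the geodesic on both sides of `c t₀`, together with nearby points of `u`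
  obtain ⟨t₁, ht₁, hle₁, hd₁, i₁, hi₁, hn₁, hg₁⟩ : ∃ t₁ ∈ Icc 0 l, t₁ ≤ t₀ ∧ t₀ - t₁ ≤ 2 * D ∧
      ∃ i ≤ n, dist (c t₁) (u i) ≤ D ∧ D ≤ gromovProduct (c t₀) (c t₁) (u i) := by
    rcases le_total 0 (t₀ - 2 * D) with h | h
    · have hm : t₀ - 2 * D ∈ Icc 0 l := ⟨h, by linarith [ht₀.2]⟩
      obtain ⟨i, hi, e⟩ := near (c (t₀ - 2 * D))
      have e' := hmax _ hm
      refine ⟨_, hm, by linarith, by linarith, i, hi, by linarith, ?_⟩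
      unfold gromovProduct
      rw [hc.isGeodesicOn _ ht₀ _ hm, sub_sub_cancel, abs_of_nonneg (by linarith)]
      linarith [far (c t₀) i hi]
    · refine ⟨0, ⟨le_rfl, hl0⟩, ht₀.1, by linarith, 0, Nat.zero_le n, ?_, ?_⟩
      · rwa [hc.map_zero, dist_self]
      · rw [hc.map_zero, gromovProduct_self]
        exact far _ 0 (Nat.zero_le n)
  obtain ⟨t₂, ht₂, hle₂, hd₂, i₂, hi₂, hn₂, hg₂⟩ : ∃ t₂ ∈ Icc 0 l, t₀ ≤ t₂ ∧ t₂ - t₀ ≤ 2 * D ∧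
      ∃ i ≤ n, dist (c t₂) (u i) ≤ D ∧ D ≤ gromovProduct (c t₀) (c t₂) (u i) := by
    rcases le_total (t₀ + 2 * D) l with h | h
    · have hm : t₀ + 2 * D ∈ Icc 0 l := ⟨by linarith [ht₀.1], h⟩
      obtain ⟨i, hi, e⟩ := near (c (t₀ + 2 * D))
      have e' := hmax _ hm
      refine ⟨_, hm, by linarith, by linarith, i, hi, by linarith, ?_⟩
      unfold gromovProduct
      rw [hc.isGeodesicOn _ ht₀ _ hm, abs_sub_comm, add_sub_cancel_left,
        abs_of_nonneg (by linarith)]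
      linarith [far (c t₀) i hi]
    · refine ⟨l, ⟨hl0, le_rfl⟩, ht₀.2, by linarith, n, le_rfl, ?_, ?_⟩
      · rwa [hc.map_dist, dist_self]
      · rw [hc.map_dist, gromovProduct_self]
        exact far _ n le_rfl
  have h12 : gromovProduct (c t₀) (c t₁) (c t₂) = 0 := by
    unfold gromovProduct
    rw [hc.isGeodesicOn _ ht₀ _ ht₁, hc.isGeodesicOn _ ht₀ _ ht₂, hc.isGeodesicOn _ ht₁ _ ht₂,
      abs_of_nonneg (by linarith), abs_of_nonpos (by linarith), abs_of_nonpos (by linarith)]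
    ring
  refine H D fun k hk => ?_
  have hdu : dist (u i₁) (u i₂) ≤ 6 * D := by
    have := dist_triangle4 (u i₁) (c t₁) (c t₂) (u i₂)
    rw [dist_comm (u i₁) (c t₁), hc.isGeodesicOn _ ht₁ _ ht₂, abs_of_nonpos (by linarith)] at this
    linarith
  have hidx : |(i₁ : ℝ) - i₂| ≤ 2 ^ k := by
    have := hu.le_dist i₁ hi₁ i₂ hi₂
    nlinarith
  have hKB : 0 ≤ K + B := by
    have := hu.dist_le 0 (Nat.zero_le n) 0 (Nat.zero_le n)
    rw [dist_self, sub_self, abs_zero, mul_zero, zero_add] at this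
    linarith
  have chain : ∀ i j : ℕ, i ≤ j → j ≤ n → (j : ℝ) - i ≤ 2 ^ k →
      D - (K + B) / 2 - k * δ ≤ gromovProduct (c t₀) (u i) (u j) := by
    intro i j hij hj hlen
    have hlen' : j - i ≤ 2 ^ k := by
      have : ((j - i : ℕ) : ℝ) ≤ ((2 ^ k : ℕ) : ℝ) := by rw [Nat.cast_sub hij]; exact_mod_cast hlen
      exact_mod_cast this
    have := hX.chain hδ.le u (c t₀) (D - (K + B) / 2) k i (j - i) hlen'
      (fun m hm => by linarith [far (c t₀) m (by omega)])
      (fun m hm => by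
        have h1 := far (c t₀) m (by omega)
        have h2 := far (c t₀) (m + 1) (by omega)
        have h3 := hu.dist_le m (by omega) (m + 1) (by omega)
        rw [Nat.cast_add, Nat.cast_one, sub_add_cancel_left, abs_neg, abs_one, mul_one] at h3
        unfold gromovProduct
        linarith)
    rwa [Nat.add_sub_cancel' hij] at this
  have hmid : D - (K + B) / 2 - k * δ ≤ gromovProduct (c t₀) (u i₁) (u i₂) := by
    rcases le_total i₁ i₂ with h | h
    · exact chain _ _ h hi₂ (by linarith [neg_abs_le ((i₁ : ℝ) - i₂)])
    · rw [gromovProduct_comm]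
      exact chain _ _ h hi₁ (by linarith [le_abs_self ((i₁ : ℝ) - i₂)])
  have f1 := hX (c t₀) (c t₁) (u i₁) (u i₂)
  have f2 := hX (c t₀) (c t₁) (u i₂) (c t₂)
  have hkδ : 0 ≤ k * δ := by positivity
  rw [gromovProduct_comm _ (c t₂)] at hg₂
  have m1 := le_min (by linarith :
    D - (K + B) / 2 - k * δ ≤ gromovProduct (c t₀) (c t₁) (u i₁)) hmid
  have m2 := le_min (by linarith :
    D - (K + B) / 2 - k * δ - δ ≤ gromovProduct (c t₀) (c t₁) (u i₂))
    (by linarith : D - (K + B) / 2 - k * δ - δ ≤ gromovProduct (c t₀) (u i₂) (c t₂))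
  linarith

/-- Two sets that cover an interval and contain one end each come close to each other. -/
theorem exists_close_of_cover {P Q : ℝ → Prop} {l : ℝ} (hl : 0 ≤ l) (hP : P 0) (hQ : Q l)
    (hPQ : ∀ t ∈ Icc 0 l, P t ∨ Q t) :
    ∃ t ∈ Icc 0 l, ∃ t' ∈ Icc 0 l, |t - t'| ≤ 1 ∧ P t ∧ Q t' := by
  classical
  have hex : ∃ n : ℕ, Q (min n l) := by
    obtain ⟨n, hn⟩ := exists_nat_ge l
    exact ⟨n, by rwa [min_eq_right hn]⟩
  have hmem : ∀ n : ℕ, min (n : ℝ) l ∈ Icc 0 l := fun n =>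
    ⟨le_min n.cast_nonneg hl, min_le_right _ _⟩
  obtain ⟨n, hn, hmin⟩ : ∃ n : ℕ, Q (min n l) ∧ ∀ m < n, ¬ Q (min (m : ℝ) l) :=
    ⟨Nat.find hex, Nat.find_spec hex, fun m hm => Nat.find_min hex hm⟩
  cases n with
  | zero =>
    rw [Nat.cast_zero, min_eq_left hl] at hn
    exact ⟨0, ⟨le_rfl, hl⟩, 0, ⟨le_rfl, hl⟩, by simp, hP, hn⟩
  | succ m =>
    refine ⟨_, hmem m, _, hmem (m + 1), ?_, (hPQ _ (hmem m)).resolve_right (hmin m (by omega)), hn⟩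
    push_cast
    rcases le_total (m : ℝ) l with h | h <;> rcases le_total ((m : ℝ) + 1) l with h' | h' <;>
      simp only [h, h', min_eq_left, min_eq_right] <;> rw [abs_le] <;> constructor <;> linarith

/-- The Morse lemma: the Gromov product of the ends of a quasi-geodesic with respect to a point in
between is bounded. -/
theorem exists_gromovProduct_le_of_quasiGeodesic {K δ : ℝ} (B : ℝ) (hK : 0 ≤ K) (hδ : 0 < δ) :
    ∃ D : ℝ, 0 ≤ D ∧ ∀ (X : Type*) [MetricSpace X], IsGromovHyperbolic X δ →
      (∀ p q : X, ∃ c : ℝ → X, IsGeodesicFromTo c p q) →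
      ∀ (u : ℕ → X) (n : ℕ), IsQuasiGeodesicSeq K B u n →
      ∀ m ≤ n, gromovProduct (u m) (u 0) (u n) ≤ D := by
  obtain ⟨D₀, hD₀, H⟩ := exists_geodesic_near_quasiGeodesic B hK hδ
  refine ⟨max 0 (K * (K * (2 * D₀ + 1 + B)) + B + D₀), le_max_left _ _,
    fun X _ hX hgeo u n hu m hm => le_max_of_le_right ?_⟩
  obtain ⟨c, hc⟩ := hgeo (u 0) (u n)
  -- Each point of the geodesic is near the part of `u` before `m` or the part after it. Where the
  -- two kinds meet, `u i` and `u j` are close with `i ≤ m ≤ j`, so `u m` is near the geodesic.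
  obtain ⟨t, ht, t', ht', htt, ⟨i, him, hi⟩, ⟨j, hjm, hjn, hj⟩⟩ := exists_close_of_cover
    (P := fun t => ∃ i ≤ m, dist (c t) (u i) ≤ D₀)
    (Q := fun t => ∃ i, m ≤ i ∧ i ≤ n ∧ dist (c t) (u i) ≤ D₀)
    (dist_nonneg (x := u 0) (y := u n)) ⟨0, Nat.zero_le m, by rwa [hc.map_zero, dist_self]⟩
    ⟨n, hm, le_rfl, by rwa [hc.map_dist, dist_self]⟩ (fun t ht => by
      obtain ⟨i, hi, hd⟩ := H X hX u n hu c hc t ht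
      rcases le_total i m with h | h
      · exact Or.inl ⟨i, h, hd⟩
      · exact Or.inr ⟨i, h, hi, hd⟩)
  have hij : dist (u i) (u j) ≤ 2 * D₀ + 1 := by
    have := dist_triangle4 (u i) (c t) (c t') (u j)
    rw [dist_comm (u i) (c t), hc.isGeodesicOn t ht t' ht'] at this
    linarith
  have h1 := hu.le_dist i (him.trans hm) j hjn
  have h2 := hu.dist_le m hm i (him.trans hm)
  have him' : (i : ℝ) ≤ m := by exact_mod_cast him
  have hjm' : (m : ℝ) ≤ j := by exact_mod_cast hjm
  rw [abs_of_nonpos (by linarith)] at h1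
  rw [abs_of_nonneg (by linarith)] at h2
  have h3 : (m : ℝ) - i ≤ K * (2 * D₀ + 1 + B) := by nlinarith
  have h4 := mul_le_mul_of_nonneg_left h3 hK
  have g0 := hc.isGeodesicOn 0 ⟨le_rfl, dist_nonneg⟩ t ht
  have g1 := hc.isGeodesicOn t ht _ ⟨dist_nonneg, le_rfl⟩
  rw [hc.map_zero, abs_of_nonpos (by linarith [ht.1])] at g0
  rw [hc.map_dist, abs_of_nonpos (by linarith [ht.2])] at g1
  have t1 := dist_triangle4 (u m) (u i) (c t) (u 0)
  have t2 := dist_triangle4 (u m) (u i) (c t) (u n)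
  rw [dist_comm (u i) (c t)] at t1 t2
  rw [dist_comm (c t) (u 0)] at t1
  unfold gromovProduct
  linarith

end Morse

/-! ### Quasi-isometric embeddings that fix the boundary. -/

section QuasiIsometry

variable {X : Type*} [MetricSpace X]

/-- A quasi-isometric embedding maps the union of two diverging rays to a quasi-geodesic. -/
theorem isQuasiGeodesicSeq_of_rays {K C δ : ℝ} (hK : 1 ≤ K) (hδ : 0 ≤ δ) {G : X → X}
    (hlow : ∀ x y, (1 / K) * dist x y - C ≤ dist (G x) (G y))
    (hup : ∀ x y, dist (G x) (G y) ≤ K * dist x y + C) {g g' : ℝ → X}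
    (hg : IsGeodesicOn g (Ici 0)) (hg' : IsGeodesicOn g' (Ici 0)) (h0 : g 0 = g' 0)
    (hdiv : ∀ s t, 0 ≤ s → 0 ≤ t → s + t - δ ≤ dist (g s) (g' t)) (N : ℕ) :
    IsQuasiGeodesicSeq K (C + δ)
      (fun k : ℕ => G (if k ≤ N then g ((N : ℝ) - k) else g' ((k : ℝ) - N))) (N + N) := by
  have hK0 : 0 < K := by linarith
  -- The sequence runs inwards along `g`, meets the common origin at index `N`, then runs outwards
  -- along `g'`. Before `G` is applied, its distances are `|i - j|` up to `δ`.
  have key : ∀ i j : ℕ,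
      |(i : ℝ) - j| - δ ≤ dist (if i ≤ N then g ((N : ℝ) - i) else g' ((i : ℝ) - N))
        (if j ≤ N then g ((N : ℝ) - j) else g' ((j : ℝ) - N)) ∧
      dist (if i ≤ N then g ((N : ℝ) - i) else g' ((i : ℝ) - N))
        (if j ≤ N then g ((N : ℝ) - j) else g' ((j : ℝ) - N)) ≤ |(i : ℝ) - j| := by
    have mixed : ∀ i j : ℕ, i ≤ N → N < j →
        |(i : ℝ) - j| - δ ≤ dist (g ((N : ℝ) - i)) (g' ((j : ℝ) - N)) ∧
        dist (g ((N : ℝ) - i)) (g' ((j : ℝ) - N)) ≤ |(i : ℝ) - j| := by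
      intro i j hi hj
      have hi' : (i : ℝ) ≤ N := by exact_mod_cast hi
      have hj' : (N : ℝ) < j := by exact_mod_cast hj
      have h1 := hdiv (N - i) (j - N) (by linarith) (by linarith)
      have h2 := dist_triangle (g ((N : ℝ) - i)) (g 0) (g' ((j : ℝ) - N))
      rw [hg _ (mem_Ici.2 (by linarith)) 0 self_mem_Ici, h0,
        hg' 0 self_mem_Ici _ (mem_Ici.2 (by linarith)), sub_zero, zero_sub, abs_neg,
        abs_of_nonneg (by linarith), abs_of_nonneg (by linarith)] at h2
      rw [abs_of_neg (by linarith)]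
      constructor <;> linarith
    intro i j
    split_ifs with hi hj hj
    · have hi' : (i : ℝ) ≤ N := by exact_mod_cast hi
      have hj' : (j : ℝ) ≤ N := by exact_mod_cast hj
      rw [hg _ (mem_Ici.2 (by linarith)) _ (mem_Ici.2 (by linarith)), sub_sub_sub_cancel_left,
        abs_sub_comm]
      exact ⟨by linarith, le_rfl⟩
    · exact mixed i j hi (by omega)
    · rw [dist_comm, abs_sub_comm]
      exact mixed j i hj (by omega)
    · have hi' : (N : ℝ) ≤ i := by exact_mod_cast (by omega : N ≤ i)
      have hj' : (N : ℝ) ≤ j := by exact_mod_cast (by omega : N ≤ j)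
      rw [hg' _ (mem_Ici.2 (by linarith)) _ (mem_Ici.2 (by linarith)), sub_sub_sub_cancel_right]
      exact ⟨by linarith, le_rfl⟩
  refine ⟨fun i _ j _ => ?_, fun i _ j _ => ?_⟩
  · have h1 := (key i j).1
    have h2 := hlow (if i ≤ N then g ((N : ℝ) - i) else g' ((i : ℝ) - N))
        (if j ≤ N then g ((N : ℝ) - j) else g' ((j : ℝ) - N))
    rw [one_div, sub_le_iff_le_add, inv_mul_le_iff₀ hK0] at h2
    nlinarith
  · have h1 := (key i j).2
    have h2 := hup (if i ≤ N then g ((N : ℝ) - i) else g' ((i : ℝ) - N))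
        (if j ≤ N then g ((N : ℝ) - j) else g' ((j : ℝ) - N))
    nlinarith

/-- A point for which three points spread around `x` have small Gromov products is close to
`x`. -/
theorem IsGromovHyperbolic.dist_le_of_tripod {δ D : ℝ} (hX : IsGromovHyperbolic X δ) {x y : X}
    {p : Fin 3 → X} (hx : ∀ i j, i ≠ j → gromovProduct x (p i) (p j) ≤ δ / 2)
    (hy : ∀ i j, i ≠ j → gromovProduct y (p i) (p j) ≤ D) : dist y x ≤ D + 3 * δ := by
  have h : ∀ i j, i ≠ j → gromovProduct x y (p i) ≤ 3 / 2 * δ ∨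
      gromovProduct x y (p j) ≤ 3 / 2 * δ := by
    intro i j hij
    by_contra! hlt
    have h1 := hX x (p i) y (p j)
    rw [gromovProduct_comm x (p i) y] at h1
    linarith [hx i j hij, lt_min hlt.1 hlt.2]
  -- At most one leg of the tripod points from `x` towards `y`; the other two see `y` behind `x`.
  obtain ⟨i, j, hij, hi, hj⟩ : ∃ i j, i ≠ j ∧ gromovProduct x y (p i) ≤ 3 / 2 * δ ∧
      gromovProduct x y (p j) ≤ 3 / 2 * δ := by
    rcases h 0 1 (by decide) with h0 | h1
    · rcases h 1 2 (by decide) with h1 | h2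
      · exact ⟨0, 1, by decide, h0, h1⟩
      · exact ⟨0, 2, by decide, h0, h2⟩
    · rcases h 0 2 (by decide) with h0 | h2
      · exact ⟨0, 1, by decide, h0, h1⟩
      · exact ⟨1, 2, by decide, h1, h2⟩
  have hD := hy i j hij
  have ht := dist_triangle_left (p i) (p j) x
  unfold gromovProduct at hD hi hj
  rw [dist_comm y x]
  linarith

/-- A quasi-isometric embedding that fixes the boundary moves every point by a bounded amount. -/
theorem exists_dist_le_of_fixes_rays {K : ℝ} (C : ℝ) (hK : 1 ≤ K) :
    ∃ L : ℝ, 0 < L ∧ ∀ (X : Type*) [MetricSpace X] [CompleteSpace X],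
      IsCATNegOne X → GeodesicExtensionProperty X →
      (∀ p : X, PreconnectedSpace (SpaceOfDirections p)) →
      ∀ G : X → X, (∀ x y, (1 / K) * dist x y - C ≤ dist (G x) (G y)) →
      (∀ x y, dist (G x) (G y) ≤ K * dist x y + C) →
      (∀ g : ℝ → X, IsGeodesicOn g (Ici 0) →
        ∃ M, ∀ s, 0 ≤ s → ∃ s', 0 ≤ s' ∧ dist (G (g s)) (g s') ≤ M) →
      ∀ x, dist (G x) x ≤ L := by
  have hδ : 0 < Real.log 4 := Real.log_pos (by norm_num)
  have hK0 : 0 < K := by linarith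
  obtain ⟨D, hD0, hD⟩ := exists_gromovProduct_le_of_quasiGeodesic (C + Real.log 4) hK0.le hδ
  refine ⟨D + 5 * Real.log 4, by linarith, fun X _ _ hX hE hdir G hlow hup hray x => ?_⟩
  rcases subsingleton_or_nontrivial X with _ | _
  · rw [Subsingleton.elim (G x) x, dist_self]
    linarith
  have := hdir x
  have hyp := hX.isGromovHyperbolic
  obtain ⟨g, hg0, hg, hdiv⟩ := hX.exists_three_rays hE x
  have morse : ∀ i j, i ≠ j → ∀ N : ℕ, gromovProduct (G x) (G (g i N)) (G (g j N)) ≤ D := by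
    intro i j hij N
    have := hD X hyp hX.exists_geodesic _ _ (isQuasiGeodesicSeq_of_rays hK hδ.le hlow hup
      (hg i) (hg j) ((hg0 i).trans (hg0 j).symm) (hdiv i j hij) N) N (by omega)
    rcases N.eq_zero_or_pos with rfl | hN
    · simpa [hg0] using this
    · simpa [hg0, show N ≠ 0 by omega] using this
  choose M hM using fun i => hray (g i) (hg i)
  -- The bounds `M i` depend on `G` and the rays. They are absorbed by `N`, on which `D` does not
  -- depend.
  obtain ⟨N, hN⟩ := exists_nat_gt (K * (D + 2 * Real.log 4 + C + (|M 0| + |M 1| + |M 2|)))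
  choose s hs hsM using fun i => hM i N N.cast_nonneg
  have hfar : ∀ i, D + 2 * Real.log 4 < gromovProduct (G x) (G (g i N)) (g i (s i)) := by
    intro i
    have h1 := hlow x (g i N)
    have h2 : dist x (g i N) = N := by
      rw [← hg0 i, hg i 0 self_mem_Ici N (mem_Ici.2 N.cast_nonneg), zero_sub, abs_neg,
        abs_of_nonneg N.cast_nonneg]
    rw [h2] at h1
    have h3 : D + 2 * Real.log 4 + C + (|M 0| + |M 1| + |M 2|) < 1 / K * N := by
      rw [one_div, lt_inv_mul_iff₀ hK0]
      exact hN
    have h4 : M i ≤ |M 0| + |M 1| + |M 2| := by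
      have := le_abs_self (M i)
      have a0 := abs_nonneg (M 0)
      have a1 := abs_nonneg (M 1)
      have a2 := abs_nonneg (M 2)
      fin_cases i <;> simp only [Fin.zero_eta, Fin.mk_one, Fin.reduceFinMk] at this ⊢ <;> linarith
    have h5 := hsM i
    have h6 := dist_triangle_right (G x) (G (g i N)) (g i (s i))
    unfold gromovProduct
    linarith
  have := hyp.dist_le_of_tripod (x := x) (y := G x) (p := fun i => g i (s i))
    (D := D + 2 * Real.log 4) ?_ ?_
  · linarith
  · intro i j hij
    have h1 := hdiv i j hij (s i) (s j) (hs i) (hs j)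
    have h2 : ∀ i, dist x (g i (s i)) = s i := by
      intro i
      rw [← hg0 i, hg i 0 self_mem_Ici _ (hs i), zero_sub, abs_neg, abs_of_nonneg (hs i)]
    unfold gromovProduct
    rw [h2 i, h2 j]
    linarith
  · intro i j hij
    have h0 := morse i j hij N
    have h1 := hyp (G x) (G (g i N)) (g i (s i)) (G (g j N))
    have h2 := hyp (G x) (g i (s i)) (g j (s j)) (G (g j N))
    rw [gromovProduct_comm _ (g j (s j))] at h2
    -- Replacing the ray points by the image points, first for `j` and then for `i`, costs `log 4`
    -- each time and would contradict the Morse bound.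
    by_contra! hlt
    have m2 := lt_min hlt (hfar j)
    have m1 := lt_min (sub_lt_self_iff _ |>.2 hδ |>.trans (hfar i)) ((sub_lt_sub_right m2 _).trans_le h2)
    linarith

/-- Rays are mapped into bounded neighbourhoods of each other by maps with the same boundary
map. -/
theorem HasBoundaryMap.exists_dist_le {Y : Type*} [MetricSpace Y] {F I : X → Y}
    {f : Boundary X → Boundary Y} (hF : HasBoundaryMap F f) (hI : Isometry I)
    (hIf : HasBoundaryMap I f) (γ : GeodesicRay X) :
    ∃ M : ℝ, ∀ s, ∃ s', dist (F (γ.toFun s)) (I (γ.toFun s')) ≤ M := by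
  let γ' : GeodesicRay Y := ⟨I ∘ γ.toFun, hI.comp γ.isometry⟩
  -- The ray `I ∘ γ` itself represents the common image of the endpoint of `γ`.
  have h := (hF γ γ').1 ((hIf γ γ').2 (by simp [γ']))
  obtain ⟨M, hM⟩ : ∃ M : ℝ≥0,
      Metric.hausdorffEDist (range (F ∘ γ.toFun)) (range γ'.toFun) < M :=
    ENNReal.lt_iff_exists_nnreal_btwn.1 h.lt_top |>.imp fun _ h => h.1
  refine ⟨M, fun s => ?_⟩
  obtain ⟨_, ⟨s', rfl⟩, hs'⟩ := Metric.exists_edist_lt_of_hausdorffEDist_lt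
    (mem_range_self (f := F ∘ γ.toFun) s) hM
  refine ⟨s', ?_⟩
  rw [edist_nndist, ENNReal.coe_lt_coe] at hs'
  exact_mod_cast hs'.le

end QuasiIsometry

theorem proposition2p3 (K C : ℝ) (hK : 1 ≤ K) (hC : 0 < C) :
    ∃ L : ℝ, 0 < L ∧
      ∀ (X : Type*) [MetricSpace X] [CompleteSpace X] [SimplyConnectedSpace X],
        IsCATNegOne X → GeodesicExtensionProperty X →
        (∀ p : X, PreconnectedSpace (SpaceOfDirections p)) →
        ∀ F : X → X, IsQuasiIsometry K C F →
        ∀ I : X ≃ᵢ X,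
        ∀ f : Boundary X → Boundary X, HasBoundaryMap F f → HasBoundaryMap I f →
          ∀ x : X, dist (F x) (I x) ≤ L := by
  obtain ⟨L, hL, H⟩ := exists_dist_le_of_fixes_rays C hK
  refine ⟨L, hL, fun X _ _ _ hX hE hdir F hF I f hFf hIf x => ?_⟩
  have := H X hX hE hdir (fun x => I.symm (F x))
    (fun x y => by rw [I.symm.dist_eq]; exact hF.lower x y)
    (fun x y => by rw [I.symm.dist_eq]; exact hF.upper x y) (fun g hg => ?_) x
  · rwa [← I.dist_eq, I.apply_symm_apply] at this
  · let γ : GeodesicRay X := ⟨fun t => g t, Isometry.of_dist_eq fun s t => by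
      rw [hg s (mem_Ici.2 s.coe_nonneg) t (mem_Ici.2 t.coe_nonneg), NNReal.dist_eq]⟩
    obtain ⟨M, hM⟩ := hFf.exists_dist_le I.isometry hIf γ
    refine ⟨M, fun s hs => ?_⟩
    obtain ⟨s', hs'⟩ := hM ⟨s, hs⟩
    refine ⟨s', s'.2, ?_⟩
    rw [← I.dist_eq, I.apply_symm_apply]
    exact hs'
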